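/- Let $(X,\mathfrak A,\mu)$ be a $\sigma$-finite measure space and let $L^0(X,\mu)$ be the space of $\mu$-a.e. classes of measurable functions $X\to\mathbb R$, with the topology of local convergence in measure (given by the metric $d(f,g)=\int_X(|f-g|\wedge 1)\,\varphi\,d\mu$ for a fixed integrable $\varphi\colon X\to(0,\infty)$). Let $q\colon L^2(X,\mu)\to[0,\infty]$ be a densely defined closed quadratic form with domain $D(q)=\{q<\infty\}$ that satisfies the first Beurling–Deny criterion $q(|f|)\le q(f)$, $f\in L^2(X,\mu)$, and is irreducible: every measurable $A\subseteq X$ with $q(1_Af)\le q(f)$ for all $f\in L^2(X,\mu)$ satisfies $\mu(A)=0$ or $\mu(X\setminus A)=0$. Let $q_e\colon L^0(X,\mu)\to[0,\infty]$ be the extended form, i.e. the closure of $q$ on $L^0(X,\mu)$: $q_e(f)=\lim_{n}q(f_n)$ if there is a $q$-Cauchy sequence $(f_n)$ in $D(q)$ with $f_n\to f$ in $L^0(X,\mu)$, and $q_e(f)=\infty$ otherwise; let $D(q_e)=\{q_e<\infty\}$ and $\ker q_e=\{q_e=0\}$. Assume that $q$ is critical, i.e. $\ker q_e=\mathbb R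 h$ for some $h\in L^0(X,\mu)$ with $h>0$ $\mu$-a.e. Theorem. The following assertions are equivalent. (i) $(D(q_e)/\mathbb R h,\,q_e)$ is a Hilbert space. (ii) The map $(D(q_e)/\mathbb R h,\,q_e)\to L^0(X,\mu)/\mathbb R h$, $f+\mathbb R h\mapsto f+\mathbb R h$, is continuous, where $L^0(X,\mu)/\mathbb R h$ carries the quotient topology. (iii) For all strictly positive $w\in L^1(X,h^2\mu)$ the following weak Poincaré inequality holds: there is a decreasing function $\alpha\colon(0,\infty)\to(0,\infty)$ such that for all $r>0$ and all $f\in L^2(X,w\mu)$ with $\int_X f h\,w\,d\mu=0$ $$\int_X f^2\,w\,d\mu\le \alpha(r)\,q_e(f)+r\,\|f/h\|_\infty^2$$ (the right-hand side may be $+\infty$). (iii') For some strictly positive $w\in L^1(X,h^2\mu)$ the weak Poincaré inequality of (iii) holds. -/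

import Mathlib

open MeasureTheory Filter Topology
open scoped ENNReal NNReal

noncomputable section

namespace ExtForm

variable {X : Type*} [MeasurableSpace X]

/-! ### The space of a.e. classes of real measurable functions -/

/-- A fixed strictly positive integrable function on a `σ`-finite measure space. -/
def weight (μ : Measure X) [SigmaFinite μ] : X → ℝ≥0 :=
  (exists_pos_lintegral_lt_of_sigmaFinite μ (ε := 1) one_ne_zero).choose

theorem weight_pos (μ : Measure X) [SigmaFinite μ] (x : X) : 0 < weight μ x :=
  (exists_pos_lintegral_lt_of_sigmaFinite μ (ε := 1) one_ne_zero).choose_spec.1 x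

theorem measurable_weight (μ : Measure X) [SigmaFinite μ] : Measurable (weight μ) :=
  (exists_pos_lintegral_lt_of_sigmaFinite μ (ε := 1) one_ne_zero).choose_spec.2.1

theorem lintegral_weight_lt_one (μ : Measure X) [SigmaFinite μ] :
    ∫⁻ x, weight μ x ∂μ < 1 :=
  (exists_pos_lintegral_lt_of_sigmaFinite μ (ε := 1) one_ne_zero).choose_spec.2.2

/-- The `F`-norm `∫ (|f| ∧ 1) φ dμ` of local convergence in measure, `φ` the fixed weight. -/
def zeroNorm (μ : Measure X) [SigmaFinite μ] (f : X →ₘ[μ] ℝ) : ℝ≥0∞ :=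
  ∫⁻ x, min ‖f x‖ₑ 1 * (weight μ x : ℝ≥0∞) ∂μ

theorem zeroNorm_zero (μ : Measure X) [SigmaFinite μ] : zeroNorm μ 0 = 0 := by
  have : ∫⁻ x, min ‖(0 : X →ₘ[μ] ℝ) x‖ₑ 1 * (weight μ x : ℝ≥0∞) ∂μ = ∫⁻ _, 0 ∂μ := by
    refine lintegral_congr_ae ?_
    filter_upwards [AEEqFun.coeFn_zero (μ := μ) (β := ℝ)] with x hx
    simp [hx]
  simpa [zeroNorm] using this

theorem zeroNorm_neg (μ : Measure X) [SigmaFinite μ] (f : X →ₘ[μ] ℝ) :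
    zeroNorm μ (-f) = zeroNorm μ f := by
  refine lintegral_congr_ae ?_
  filter_upwards [AEEqFun.coeFn_neg f] with x hx
  simp [hx]

theorem zeroNorm_add_le (μ : Measure X) [SigmaFinite μ] (f g : X →ₘ[μ] ℝ) :
    zeroNorm μ (f + g) ≤ zeroNorm μ f + zeroNorm μ g := by
  unfold zeroNorm
  rw [← lintegral_add_left']
  · refine lintegral_mono_ae ?_
    filter_upwards [AEEqFun.coeFn_add f g] with x hx
    rw [hx, ← add_mul]
    gcongr
    have h1 : ‖f x + g x‖ₑ ≤ ‖f x‖ₑ + ‖g x‖ₑ := enorm_add_le _ _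
    rcases le_total ‖f x‖ₑ 1 with h2 | h2 <;> rcases le_total ‖g x‖ₑ 1 with h3 | h3 <;>
      simp only [Pi.add_apply, min_eq_left, min_eq_right, h2, h3, min_le_iff]
    · exact Or.inl h1
    · exact Or.inr le_add_self
    · exact Or.inr le_self_add
    · exact Or.inr le_self_add
  · exact ((f.aestronglyMeasurable.enorm.min aemeasurable_const).mul
      (measurable_weight μ).coe_nnreal_ennreal.aemeasurable)

theorem zeroNorm_smul_le (μ : Measure X) [SigmaFinite μ] (c : ℝ) (f : X →ₘ[μ] ℝ) :
    zeroNorm μ (c • f) ≤ max ‖c‖ₑ 1 * zeroNorm μ f := by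
  unfold zeroNorm
  rw [← lintegral_const_mul' _ _ (by simp)]
  refine lintegral_mono_ae ?_
  filter_upwards [AEEqFun.coeFn_smul c f] with x hx
  rw [hx, ← mul_assoc]
  gcongr
  simp only [Pi.smul_apply, smul_eq_mul, enorm_mul]
  rcases le_total ‖f x‖ₑ 1 with h2 | h2
  · rw [min_eq_left h2]
    exact (min_le_left _ _).trans (by gcongr; exact le_max_left _ _)
  · rw [min_eq_right h2, mul_one]
    exact (min_le_right _ _).trans (le_max_right _ _)

/-- The translation invariant (pseudo)metric induced by the `F`-norm. -/
abbrev zeroPseudoEMetric (μ : Measure X) [SigmaFinite μ] : PseudoEMetricSpace (X →ₘ[μ] ℝ) where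
  edist f g := zeroNorm μ (f - g)
  edist_self f := by
    change zeroNorm μ (f - f) = 0
    rw [sub_self, zeroNorm_zero]
  edist_comm f g := by
    change zeroNorm μ (f - g) = zeroNorm μ (g - f)
    rw [← zeroNorm_neg, neg_sub]
  edist_triangle f g k := by
    change zeroNorm μ (f - k) ≤ zeroNorm μ (f - g) + zeroNorm μ (g - k)
    rw [← sub_add_sub_cancel f g k]
    exact zeroNorm_add_le μ _ _

/-- The topology of local convergence in measure on the space of a.e. classes of functions. -/
abbrev zeroTopology (μ : Measure X) [SigmaFinite μ] : TopologicalSpace (X →ₘ[μ] ℝ) :=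
  (zeroPseudoEMetric μ).toUniformSpace.toTopologicalSpace

/-- The sequence `u` converges to `f` locally in measure. -/
def ZeroTendsto (μ : Measure X) [SigmaFinite μ] (u : ℕ → X →ₘ[μ] ℝ) (f : X →ₘ[μ] ℝ) : Prop :=
  Tendsto (fun n => zeroNorm μ (u n - f)) atTop (𝓝 0)

/-! ### Quadratic forms on `L²` -/

/-- A quadratic form `L²(X, μ) → [0, ∞]`, given by its domain (the set where it is finite) and
its restriction to the domain. -/
structure L2Form (μ : Measure X) where
  domain : Submodule ℝ (Lp ℝ 2 μ)
  form : QuadraticForm ℝ domain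
  nonneg : ∀ f, 0 ≤ form f

namespace L2Form

variable {μ : Measure X}

open Classical in
/-- The value in `[0, ∞]` of the form on an arbitrary `f ∈ L²`. -/
def value (q : L2Form μ) (f : Lp ℝ 2 μ) : ℝ≥0∞ :=
  if hf : f ∈ q.domain then ENNReal.ofReal (q.form ⟨f, hf⟩) else ⊤

/-- `u` is a `q`-Cauchy sequence in `D(q)`. -/
def IsFormCauchy (q : L2Form μ) (u : ℕ → q.domain) : Prop :=
  ∀ ε : ℝ, 0 < ε → ∃ N, ∀ m, N ≤ m → ∀ n, N ≤ n → q.form (u m - u n) < ε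

/-- `q` is closed: `D(q)` is complete for the metric `q(f - g)^{1/2} + ‖f - g‖₂`. -/
def IsClosedForm (q : L2Form μ) : Prop :=
  ∀ u : ℕ → q.domain, q.IsFormCauchy u → CauchySeq (fun n => (u n : Lp ℝ 2 μ)) →
    ∃ f : q.domain, Tendsto (fun n => q.form (u n - f)) atTop (𝓝 0) ∧
      Tendsto (fun n => (u n : Lp ℝ 2 μ)) atTop (𝓝 (f : Lp ℝ 2 μ))

/-- `q` is densely defined. -/
def DenselyDefined (q : L2Form μ) : Prop :=
  Dense (q.domain : Set (Lp ℝ 2 μ))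

/-- The first Beurling-Deny criterion. -/
def FirstBeurlingDeny (q : L2Form μ) : Prop :=
  ∀ f : Lp ℝ 2 μ, q.value |f| ≤ q.value f

/-- The class of `1_A f`. -/
def cutoff {A : Set X} (hA : MeasurableSet A) (f : Lp ℝ 2 μ) : Lp ℝ 2 μ :=
  ((Lp.memLp f).indicator hA).toLp (A.indicator f)

/-- The measurable set `A` is `q`-invariant. -/
def IsInvariant (q : L2Form μ) {A : Set X} (hA : MeasurableSet A) : Prop :=
  ∀ f : Lp ℝ 2 μ, q.value (cutoff hA f) ≤ q.value f

/-- `q` is irreducible. -/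
def Irreducible (q : L2Form μ) : Prop :=
  ∀ (A : Set X) (hA : MeasurableSet A), q.IsInvariant hA → μ A = 0 ∨ μ Aᶜ = 0

theorem polar_sq_le (q : L2Form μ) (f g : q.domain) :
    (QuadraticMap.polar q.form f g) ^ 2 ≤ 4 * q.form f * q.form g := by
  have h : ∀ t : ℝ,
      0 ≤ q.form g * (t * t) + QuadraticMap.polar q.form f g * t + q.form f := by
    intro t
    have h0 := q.nonneg (f + t • g)
    have h1 : QuadraticMap.polar q.form f (t • g) = t * QuadraticMap.polar q.form f g := by
      rw [QuadraticMap.polar_smul_right, smul_eq_mul]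
    have h2 : q.form (f + t • g) = q.form f + q.form (t • g) +
        QuadraticMap.polar q.form f (t • g) := by
      simp [QuadraticMap.polar]
    rw [h2, h1, QuadraticMap.map_smul, smul_eq_mul] at h0
    linarith
  have := discrim_le_zero h
  rw [discrim] at this
  linarith

/-- The seminorm `q^{1/2}` on `D(q)`. -/
def seminorm (q : L2Form μ) : Seminorm ℝ q.domain :=
  Seminorm.ofSMulLE (fun f => √(q.form f)) (by simp)
    (fun f g => by
      rw [Real.sqrt_le_left (by positivity)]
      have h2 : q.form (f + g) = q.form f + q.form g + QuadraticMap.polar q.form f g := by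
        simp [QuadraticMap.polar]
      have h3 := q.polar_sq_le f g
      have h4 : QuadraticMap.polar q.form f g ≤ 2 * (√(q.form f) * √(q.form g)) := by
        refine le_of_abs_le (abs_le_of_sq_le_sq ?_ (by positivity))
        rw [mul_pow, mul_pow, Real.sq_sqrt (q.nonneg f), Real.sq_sqrt (q.nonneg g)]
        linarith
      nlinarith [Real.sq_sqrt (q.nonneg f), Real.sq_sqrt (q.nonneg g)])
    (fun c f => by
      rw [QuadraticMap.map_smul, smul_eq_mul, Real.sqrt_mul (mul_self_nonneg c),
        Real.sqrt_mul_self_eq_abs, Real.norm_eq_abs])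

theorem seminorm_sq (q : L2Form μ) (f : q.domain) : q.seminorm f ^ 2 = q.form f :=
  Real.sq_sqrt (q.nonneg f)

theorem isFormCauchy_iff (q : L2Form μ) (u : ℕ → q.domain) :
    q.IsFormCauchy u ↔
      ∀ ε : ℝ, 0 < ε → ∃ N, ∀ m, N ≤ m → ∀ n, N ≤ n → q.seminorm (u m - u n) < ε := by
  constructor
  · intro h ε hε
    obtain ⟨N, hN⟩ := h (ε ^ 2) (by positivity)
    refine ⟨N, fun m hm n hn => ?_⟩
    have := hN m hm n hn
    rw [← seminorm_sq] at this
    exact lt_of_pow_lt_pow_left₀ 2 hε.le this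
  · intro h ε hε
    obtain ⟨N, hN⟩ := h (√ε) (by positivity)
    refine ⟨N, fun m hm n hn => ?_⟩
    have := hN m hm n hn
    rw [← seminorm_sq, ← Real.sq_sqrt hε.le]
    exact pow_lt_pow_left₀ this (apply_nonneg _ _) two_ne_zero

theorem IsFormCauchy.add {q : L2Form μ} {u v : ℕ → q.domain} (hu : q.IsFormCauchy u)
    (hv : q.IsFormCauchy v) : q.IsFormCauchy (u + v) := by
  rw [isFormCauchy_iff] at *
  intro ε hε
  obtain ⟨N, hN⟩ := hu (ε / 2) (by positivity)
  obtain ⟨M, hM⟩ := hv (ε / 2) (by positivity)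
  refine ⟨max N M, fun m hm n hn => ?_⟩
  have h1 := hN m (le_of_max_le_left hm) n (le_of_max_le_left hn)
  have h2 := hM m (le_of_max_le_right hm) n (le_of_max_le_right hn)
  have h3 : (u + v) m - (u + v) n = (u m - u n) + (v m - v n) := by
    simp only [Pi.add_apply]; abel
  rw [h3]
  linarith [map_add_le_add q.seminorm (u m - u n) (v m - v n)]

theorem IsFormCauchy.smul {q : L2Form μ} {u : ℕ → q.domain} (hu : q.IsFormCauchy u) (c : ℝ) :
    q.IsFormCauchy (c • u) := by
  rw [isFormCauchy_iff] at *
  intro ε hε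
  obtain ⟨N, hN⟩ := hu (ε / (|c| + 1)) (by positivity)
  refine ⟨N, fun m hm n hn => ?_⟩
  have h1 := hN m hm n hn
  rw [Pi.smul_apply, Pi.smul_apply, ← smul_sub, map_smul_eq_mul, Real.norm_eq_abs]
  rw [lt_div_iff₀ (by positivity)] at h1
  nlinarith [apply_nonneg q.seminorm (u m - u n)]

theorem IsFormCauchy.exists_tendsto {q : L2Form μ} {u : ℕ → q.domain} (hu : q.IsFormCauchy u) :
    ∃ l : ℝ, Tendsto (fun n => q.seminorm (u n)) atTop (𝓝 l) := by
  rw [isFormCauchy_iff] at hu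
  refine cauchySeq_tendsto_of_complete (Metric.cauchySeq_iff.2 fun ε hε => ?_)
  obtain ⟨N, hN⟩ := hu ε hε
  refine ⟨N, fun m hm n hn => lt_of_le_of_lt ?_ (hN m hm n hn)⟩
  rw [Real.dist_eq]
  exact abs_sub_map_le_sub q.seminorm _ _

/-! ### The extended form -/

variable [SigmaFinite μ]

/-- `u` is a `q`-Cauchy sequence in `D(q)` converging to `f` locally in measure. -/
def Approximates (q : L2Form μ) (u : ℕ → q.domain) (f : X →ₘ[μ] ℝ) : Prop :=
  q.IsFormCauchy u ∧ ZeroTendsto μ (fun n => ((u n : Lp ℝ 2 μ) : X →ₘ[μ] ℝ)) f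

/-- The extended form, i.e. the closure of `q` on the space of a.e. classes of functions:
its value at `f` is the limit of `q (u n)` for a `q`-Cauchy sequence `u` in `D(q)` converging to
`f` locally in measure, and `∞` if there is no such sequence.  (For closed forms with the first
Beurling-Deny criterion the limit does not depend on `u`, so that the infimum is over at most one
number.) -/
def ext (q : L2Form μ) (f : X →ₘ[μ] ℝ) : ℝ≥0∞ :=
  sInf {c | ∃ u : ℕ → q.domain, q.Approximates u f ∧
    Tendsto (fun n => ENNReal.ofReal (q.form (u n))) atTop (𝓝 c)}

theorem Approximates.add {q : L2Form μ} {u v : ℕ → q.domain} {f g : X →ₘ[μ] ℝ}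
    (hu : q.Approximates u f) (hv : q.Approximates v g) : q.Approximates (u + v) (f + g) := by
  refine ⟨hu.1.add hv.1, ?_⟩
  have h := Tendsto.add hu.2 hv.2
  rw [add_zero] at h
  refine tendsto_of_tendsto_of_tendsto_of_le_of_le tendsto_const_nhds h
    (fun _ => bot_le) (fun n => ?_)
  have h3 : (((u + v) n : Lp ℝ 2 μ) : X →ₘ[μ] ℝ) - (f + g) =
      (((u n : Lp ℝ 2 μ) : X →ₘ[μ] ℝ) - f) + (((v n : Lp ℝ 2 μ) : X →ₘ[μ] ℝ) - g) := by
    simp only [Pi.add_apply, Submodule.coe_add, AddSubgroup.coe_add]; abel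
  change zeroNorm μ ((((u + v) n : Lp ℝ 2 μ) : X →ₘ[μ] ℝ) - (f + g)) ≤ _
  rw [h3]
  exact zeroNorm_add_le μ _ _

theorem Approximates.smul {q : L2Form μ} {u : ℕ → q.domain} {f : X →ₘ[μ] ℝ}
    (hu : q.Approximates u f) (c : ℝ) : q.Approximates (c • u) (c • f) := by
  refine ⟨hu.1.smul c, ?_⟩
  have h := ENNReal.Tendsto.const_mul (a := max ‖c‖ₑ 1) hu.2 (Or.inr (by simp))
  rw [mul_zero] at h
  refine tendsto_of_tendsto_of_tendsto_of_le_of_le tendsto_const_nhds h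
    (fun _ => bot_le) (fun n => ?_)
  have h3 : (((c • u) n : Lp ℝ 2 μ) : X →ₘ[μ] ℝ) - c • f =
      c • (((u n : Lp ℝ 2 μ) : X →ₘ[μ] ℝ) - f) := by
    rw [smul_sub]; rfl
  change zeroNorm μ ((((c • u) n : Lp ℝ 2 μ) : X →ₘ[μ] ℝ) - c • f) ≤ _
  rw [h3]
  exact zeroNorm_smul_le μ c _

theorem ext_zero (q : L2Form μ) : q.ext 0 = 0 := by
  refine le_antisymm (sInf_le ⟨0, ⟨?_, ?_⟩, ?_⟩) bot_le
  · intro ε hε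
    exact ⟨0, fun m _ n _ => by simpa using hε⟩
  · change Tendsto (fun _ => zeroNorm μ (((0 : Lp ℝ 2 μ) : X →ₘ[μ] ℝ) - 0)) atTop (𝓝 0)
    have : ((0 : Lp ℝ 2 μ) : X →ₘ[μ] ℝ) - 0 = 0 := by simp
    rw [this, zeroNorm_zero]
    exact tendsto_const_nhds
  · simp

/-- If `q_e(f) < a²`, then `f` has an approximating sequence with `lim q(u n)^{1/2} < a`. -/
theorem exists_approx {q : L2Form μ} {f : X →ₘ[μ] ℝ} {a : ℝ} (ha : 0 ≤ a)
    (h : q.ext f < ENNReal.ofReal (a ^ 2)) :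
    ∃ u : ℕ → q.domain, q.Approximates u f ∧
      ∃ l : ℝ, Tendsto (fun n => q.seminorm (u n)) atTop (𝓝 l) ∧ l ≤ a := by
  obtain ⟨c, ⟨u, hu, hc⟩, hca⟩ := sInf_lt_iff.1 h
  obtain ⟨l, hl⟩ := hu.1.exists_tendsto
  have h0 : 0 ≤ l := ge_of_tendsto' hl fun n => apply_nonneg _ _
  refine ⟨u, hu, l, hl, ?_⟩
  have h1 : Tendsto (fun n => ENNReal.ofReal (q.form (u n))) atTop
      (𝓝 (ENNReal.ofReal (l ^ 2))) := by
    refine ENNReal.tendsto_ofReal ?_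
    simpa only [seminorm_sq] using hl.pow 2
  rw [tendsto_nhds_unique hc h1] at hca
  exact le_of_abs_le (abs_le_of_sq_le_sq (ENNReal.ofReal_lt_ofReal_iff'.1 hca).1.le ha)

theorem ext_le {q : L2Form μ} {f : X →ₘ[μ] ℝ} {u : ℕ → q.domain} (hu : q.Approximates u f)
    {a : ℝ} (ha : ∀ l : ℝ, Tendsto (fun n => q.seminorm (u n)) atTop (𝓝 l) → l ≤ a) :
    q.ext f ≤ ENNReal.ofReal (a ^ 2) := by
  obtain ⟨l, hl⟩ := hu.1.exists_tendsto
  have h0 : 0 ≤ l := ge_of_tendsto' hl fun n => apply_nonneg _ _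
  refine (sInf_le ⟨u, hu, ?_⟩ : q.ext f ≤ ENNReal.ofReal (l ^ 2)).trans
    (ENNReal.ofReal_le_ofReal (pow_le_pow_left₀ h0 (ha l hl) 2))
  refine ENNReal.tendsto_ofReal ?_
  simpa only [seminorm_sq] using hl.pow 2

theorem ext_add_le {q : L2Form μ} {f g : X →ₘ[μ] ℝ} {a b : ℝ} (ha : 0 ≤ a) (hb : 0 ≤ b)
    (hf : q.ext f < ENNReal.ofReal (a ^ 2)) (hg : q.ext g < ENNReal.ofReal (b ^ 2)) :
    q.ext (f + g) ≤ ENNReal.ofReal ((a + b) ^ 2) := by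
  obtain ⟨u, hu, l, hl, hla⟩ := exists_approx ha hf
  obtain ⟨v, hv, k, hk, hkb⟩ := exists_approx hb hg
  refine ext_le (hu.add hv) fun j hj => ?_
  have := le_of_tendsto_of_tendsto' hj (hl.add hk) fun n =>
    map_add_le_add q.seminorm (u n) (v n)
  linarith

theorem ext_smul_le {q : L2Form μ} {f : X →ₘ[μ] ℝ} {a : ℝ} (ha : 0 ≤ a)
    (hf : q.ext f < ENNReal.ofReal (a ^ 2)) (c : ℝ) :
    q.ext (c • f) ≤ ENNReal.ofReal ((|c| * a) ^ 2) := by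
  obtain ⟨u, hu, l, hl, hla⟩ := exists_approx ha hf
  refine ext_le (hu.smul c) fun j hj => ?_
  have h1 : Tendsto (fun n => q.seminorm ((c • u) n)) atTop (𝓝 (|c| * l)) := by
    simpa [map_smul_eq_mul] using hl.const_mul |c|
  rw [tendsto_nhds_unique hj h1]
  exact mul_le_mul_of_nonneg_left hla (abs_nonneg c)

theorem lt_ofReal_sq {q : L2Form μ} {f : X →ₘ[μ] ℝ} (hf : q.ext f < ⊤) {a : ℝ}
    (ha : √(q.ext f).toReal < a) : q.ext f < ENNReal.ofReal (a ^ 2) := by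
  rw [ENNReal.lt_ofReal_iff_toReal_lt hf.ne]
  exact (Real.sqrt_lt' ((Real.sqrt_nonneg _).trans_lt ha)).1 ha

theorem sqrt_le_of_ext_le {q : L2Form μ} {f : X →ₘ[μ] ℝ} {a : ℝ} (ha : 0 ≤ a)
    (h : q.ext f ≤ ENNReal.ofReal (a ^ 2)) : √(q.ext f).toReal ≤ a :=
  Real.sqrt_le_iff.2 ⟨ha, ENNReal.toReal_le_of_le_ofReal (by positivity) h⟩

/-- The domain `D(q_e)` of the extended form. -/
def extDomain (q : L2Form μ) : Submodule ℝ (X →ₘ[μ] ℝ) where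
  carrier := {f | q.ext f < ⊤}
  zero_mem' := by simp [ext_zero]
  add_mem' {f g} hf hg :=
    (ext_add_le (by positivity) (by positivity) (lt_ofReal_sq hf (lt_add_one _))
      (lt_ofReal_sq hg (lt_add_one _))).trans_lt ENNReal.ofReal_lt_top
  smul_mem' c f hf :=
    (ext_smul_le (by positivity) (lt_ofReal_sq hf (lt_add_one _)) c).trans_lt
      ENNReal.ofReal_lt_top

/-- The seminorm `q_e^{1/2}` on `D(q_e)`. -/
def extSeminorm (q : L2Form μ) : Seminorm ℝ q.extDomain :=
  Seminorm.ofSMulLE (fun f => √(q.ext f).toReal) (by simp [ext_zero])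
    (fun f g => by
      refine le_of_forall_pos_le_add fun ε hε => ?_
      have h := sqrt_le_of_ext_le (by positivity)
        (ext_add_le (a := √(q.ext f).toReal + ε / 2) (b := √(q.ext g).toReal + ε / 2)
          (by positivity) (by positivity) (lt_ofReal_sq f.2 (by linarith))
          (lt_ofReal_sq g.2 (by linarith)))
      rw [Submodule.coe_add]
      linarith)
    (fun c f => by
      refine le_of_forall_pos_le_add fun ε hε => ?_
      have h := sqrt_le_of_ext_le (by positivity)
        (ext_smul_le (a := √(q.ext f).toReal + ε / (|c| + 1)) (by positivity)
          (lt_ofReal_sq f.2 (by linarith [show 0 < ε / (|c| + 1) by positivity])) c)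
      rw [Submodule.coe_smul, Real.norm_eq_abs]
      have h2 : |c| * (ε / (|c| + 1)) ≤ ε := by
        rw [mul_div_assoc', div_le_iff₀ (by positivity)]
        nlinarith [abs_nonneg c]
      rw [mul_add] at h
      linarith)

/-- The topology on `D(q_e)` induced by the seminorm `q_e^{1/2}` alone. -/
abbrev extTopology (q : L2Form μ) : TopologicalSpace q.extDomain :=
  q.extSeminorm.toSeminormedAddCommGroup.toPseudoMetricSpace.toUniformSpace.toTopologicalSpace

/-! ### Quotients -/

/-- The quotient `D(q_e) / K`, for a subspace `K`. -/
abbrev ExtQuotient (q : L2Form μ) (K : Submodule ℝ (X →ₘ[μ] ℝ)) : Type _ :=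
  q.extDomain ⧸ K.comap q.extDomain.subtype

/-- `(D(q_e) / K, q_e)` is a Hilbert space: there is an inner product on the quotient space whose
associated quadratic form is `f + K ↦ q_e(f)`, and the quotient space is complete for it. -/
def IsHilbertQuotient (q : L2Form μ) (K : Submodule ℝ (X →ₘ[μ] ℝ)) : Prop :=
  ∃ c : InnerProductSpace.Core ℝ (q.ExtQuotient K),
    (∀ f : q.extDomain,
      c.inner (Submodule.Quotient.mk f) (Submodule.Quotient.mk f) = (q.ext f).toReal) ∧
    @CompleteSpace (q.ExtQuotient K)
      c.toNormedAddCommGroup.toPseudoMetricSpace.toUniformSpace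

/-- The natural map `D(q_e) / K → L⁰ / K`, `f + K ↦ f + K`. -/
def quotientMap (q : L2Form μ) (K : Submodule ℝ (X →ₘ[μ] ℝ)) :
    q.ExtQuotient K →ₗ[ℝ] (X →ₘ[μ] ℝ) ⧸ K :=
  Submodule.mapQ (K.comap q.extDomain.subtype) K q.extDomain.subtype le_rfl

/-- The natural map `(D(q_e) / K, q_e) → L⁰ / K` is continuous.  The topology on `D(q_e) / K` is
the quotient of the topology of the seminorm `q_e^{1/2}`; if `q_e` vanishes on `K`, this is the
topology of the seminorm `f + K ↦ q_e(f)^{1/2}`. -/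
def IsContinuousQuotientMap (q : L2Form μ) (K : Submodule ℝ (X →ₘ[μ] ℝ)) : Prop :=
  @Continuous (q.ExtQuotient K) ((X →ₘ[μ] ℝ) ⧸ K)
    (q.extTopology.coinduced (Submodule.mkQ (K.comap q.extDomain.subtype)))
    ((zeroTopology μ).coinduced (Submodule.mkQ K))
    (q.quotientMap K)

/-! ### Criticality and the weak Poincaré inequality -/

/-- `f > 0` almost everywhere. -/
def _root_.ExtForm.StrictlyPositive (f : X →ₘ[μ] ℝ) : Prop :=
  ∀ᵐ x ∂μ, 0 < f x

/-- `h` is an Agmon ground state of `q`: it is strictly positive and `ker q_e = ℝ h`. -/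
def IsAgmonGroundState (q : L2Form μ) (h : X →ₘ[μ] ℝ) : Prop :=
  StrictlyPositive h ∧
    {f : X →ₘ[μ] ℝ | q.ext f = 0} = (Submodule.span ℝ {h} : Set (X →ₘ[μ] ℝ))

/-- `w` is strictly positive and `w ∈ L¹(X, h² μ)`. -/
def _root_.ExtForm.IsAdmissibleWeight (h w : X →ₘ[μ] ℝ) : Prop :=
  StrictlyPositive w ∧ Integrable (fun x => w x * h x ^ 2) μ

/-- The weak Poincaré inequality with respect to `h` and `w`: for some decreasing
`α : (0, ∞) → (0, ∞)`, the inequality `∫ f² w dμ ≤ α(r) q_e(f) + r ‖f / h‖_∞²` holds in `[0, ∞]`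
for all `f ∈ L²(X, w μ)` orthogonal to `h` in `L²(X, w μ)` and all `r > 0`. -/
def WeakPoincare (q : L2Form μ) (h w : X →ₘ[μ] ℝ) : Prop :=
  ∃ α : ℝ → ℝ, (∀ r, 0 < r → 0 < α r) ∧ AntitoneOn α (Set.Ioi 0) ∧
    ∀ f : X →ₘ[μ] ℝ, Integrable (fun x => f x ^ 2 * w x) μ →
      ∫ x, f x * h x * w x ∂μ = 0 →
      ∀ r : ℝ, 0 < r →
        ∫⁻ x, ENNReal.ofReal (f x ^ 2 * w x) ∂μ ≤
          ENNReal.ofReal (α r) * q.ext f +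
            ENNReal.ofReal r * eLpNorm (fun x => f x / h x) ⊤ μ ^ 2

end L2Form

end ExtForm

end

open MeasureTheory Filter Topology
open scoped ENNReal NNReal

noncomputable section

namespace ExtForm

variable {X : Type*} [MeasurableSpace X]

/-! ### Local convergence in measure -/

section LocalConvergence

variable {μ : Measure X} [SigmaFinite μ]

/-! Everything reduces to the seminorm `q_e^{1/2}` on `D(q_e)`, whose null space is `ℝ h`. It
satisfies the parallelogram law, so (i) says that it is complete (`isHilbertQuotient_iff`).
Assertion (ii) says that a small seminorm of `f` makes `f + c h` small in `L⁰` for some real `c`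
(`isContinuousQuotientMap_span_iff`). The two basic tools are the completeness of `L⁰` and the lower
semicontinuity of `q_e` on `L⁰` (`ext_le_of_form_le`, `ext_le_of_zeroTendsto`).

(ii) ⇒ (i): the increments of a fast Cauchy sequence, shifted by multiples of `h`, are summable in
`L⁰`; by lower semicontinuity the sum is also a limit for `q_e`.

(i) ⇒ (ii): the distance in `L⁰` to `ℝ h` is countably subadditive on `D(q_e)`, because a limit on
which `q_e` vanishes lies in `ℝ h`. A Baire category argument
(`exists_delta_of_countably_subadditive`) then gives continuity at `0`.

(ii) ⇒ (iii): a violation of the inequality for every constant yields, after scaling, `|g n| ≤ h`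
orthogonal to `h` with `q_e(g n) → 0` and `∫ (g n)² w ≥ r`. By (ii) some `g n + c n h` tends to `0`
in `L⁰`; orthogonality forces `c n → 0` along a subsequence, and dominated convergence contradicts
the lower bound.

(iii') ⇒ (ii): shift `f` by a multiple of `h` so that its truncation between `-h` and `h` is
orthogonal to `h`. Truncation does not increase `q_e`, so the inequality makes the truncations small
in `L²(w μ)`; where a truncation is below `h` in absolute value, it equals the shifted function. -/

theorem zeroNorm_le_add_of_ae {f g k : X →ₘ[μ] ℝ} (h : ∀ᵐ x ∂μ, |f x| ≤ |g x| + |k x|) :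
    zeroNorm μ f ≤ zeroNorm μ g + zeroNorm μ k := by
  have habs : ∀ g : X →ₘ[μ] ℝ, zeroNorm μ |g| = zeroNorm μ g := fun g => by
    refine lintegral_congr_ae ?_
    filter_upwards [AEEqFun.coeFn_abs g] with x hx
    simp [hx]
  rw [← habs g, ← habs k]
  refine le_trans (lintegral_mono_ae ?_) (zeroNorm_add_le μ |g| |k|)
  filter_upwards [AEEqFun.coeFn_add |g| |k|, AEEqFun.coeFn_abs g, AEEqFun.coeFn_abs k, h]
    with x h1 h2 h3 h4
  gcongr
  rw [h1, Pi.add_apply, h2, h3, enorm_le_iff_norm_le, Real.norm_eq_abs, Real.norm_eq_abs]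
  exact h4.trans (le_abs_self _)

theorem zeroNorm_sum_le {ι : Type*} (s : Finset ι) (f : ι → X →ₘ[μ] ℝ) :
    zeroNorm μ (∑ i ∈ s, f i) ≤ ∑ i ∈ s, zeroNorm μ (f i) := by
  classical
  induction s using Finset.induction_on with
  | empty => simp [zeroNorm_zero]
  | insert a s ha ih =>
    rw [Finset.sum_insert ha, Finset.sum_insert ha]
    exact (zeroNorm_add_le μ _ _).trans (by gcongr)

theorem aemeasurable_zeroNorm_integrand (f : X →ₘ[μ] ℝ) :
    AEMeasurable (fun x => min ‖f x‖ₑ 1 * (weight μ x : ℝ≥0∞)) μ :=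
  (f.aestronglyMeasurable.enorm.min aemeasurable_const).mul
    (measurable_weight μ).coe_nnreal_ennreal.aemeasurable

/-- By Tonelli the sum of the integrands is finite a.e., and the weight is positive, so `∑ min |f n
x| 1` converges. Its terms are then eventually below `1`, where the minimum is `|f n x|` itself. -/
theorem ae_summable_of_tsum_zeroNorm {f : ℕ → X →ₘ[μ] ℝ} (h : ∑' n, zeroNorm μ (f n) ≠ ⊤) :
    ∀ᵐ x ∂μ, Summable fun n => ‖f n x‖ := by
  unfold zeroNorm at h
  rw [← lintegral_tsum fun n => aemeasurable_zeroNorm_integrand (f n)] at h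
  filter_upwards [ae_lt_top' (AEMeasurable.tsum fun n =>
    aemeasurable_zeroNorm_integrand (f n)) h] with x hx
  rw [ENNReal.tsum_mul_right] at hx
  have h1 : ∑' n, min ‖f n x‖ₑ 1 ≠ ⊤ := by
    intro h2
    rw [h2, ENNReal.top_mul (by simpa using (weight_pos μ x).ne')] at hx
    exact hx.ne rfl
  have h2 : ∀ᶠ n in atTop, min ‖f n x‖ₑ 1 < 1 :=
    (ENNReal.tendsto_atTop_zero_of_tsum_ne_top h1).eventually_lt_const one_pos
  have h3 : Summable fun n => (min ‖f n x‖ₑ 1).toReal := ENNReal.summable_toReal h1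
  refine h3.congr_atTop ?_
  filter_upwards [h2] with n hn
  rcases le_total ‖f n x‖ₑ 1 with h4 | h4
  · simp [min_eq_left h4]
  · simp [min_eq_right h4] at hn

theorem zeroTendsto_of_ae {u : ℕ → X →ₘ[μ] ℝ} {f : X →ₘ[μ] ℝ}
    (h : ∀ᵐ x ∂μ, Tendsto (fun n => u n x) atTop (𝓝 (f x))) : ZeroTendsto μ u f := by
  have h0 : Tendsto (fun n => zeroNorm μ (u n - f)) atTop (𝓝 (∫⁻ _, 0 ∂μ)) := by
    refine tendsto_lintegral_of_dominated_convergence' (fun x => (weight μ x : ℝ≥0∞))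
      (fun n => aemeasurable_zeroNorm_integrand _) (fun n => Eventually.of_forall fun x => ?_)
      ((lintegral_weight_lt_one μ).trans ENNReal.one_lt_top).ne ?_
    · exact mul_le_of_le_one_left' (min_le_right _ _)
    · filter_upwards [h, ae_all_iff.2 fun n => AEEqFun.coeFn_sub (u n) f] with x hx hs
      have h1 : Tendsto (fun n => ‖u n x - f x‖ₑ) atTop (𝓝 0) := by
        simpa using (hx.sub_const (f x)).enorm
      have h2 := ENNReal.Tendsto.mul_const (b := (weight μ x : ℝ≥0∞))
        (h1.min (tendsto_const_nhds (x := (1 : ℝ≥0∞)))) (Or.inr (by simp))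
      simpa [hs] using h2
  simpa [ZeroTendsto] using h0

theorem ZeroTendsto.exists_seq_ae {u : ℕ → X →ₘ[μ] ℝ} {f : X →ₘ[μ] ℝ}
    (h : ZeroTendsto μ u f) : ∃ φ : ℕ → ℕ, StrictMono φ ∧
      ∀ᵐ x ∂μ, Tendsto (fun n => u (φ n) x) atTop (𝓝 (f x)) := by
  obtain ⟨φ, hφ, hle⟩ := extraction_forall_of_eventually fun n : ℕ =>
    h.eventually_le_const (u := (2⁻¹ : ℝ≥0∞) ^ n) (by simp [pos_iff_ne_zero])
  refine ⟨φ, hφ, ?_⟩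
  have hs : ∑' n, zeroNorm μ (u (φ n) - f) ≠ ⊤ := by
    refine ((ENNReal.tsum_le_tsum hle).trans_lt ?_).ne
    rw [ENNReal.tsum_geometric, ENNReal.one_sub_inv_two, inv_inv]
    exact ENNReal.ofNat_lt_top
  filter_upwards [ae_summable_of_tsum_zeroNorm hs,
    ae_all_iff.2 fun n => AEEqFun.coeFn_sub (u (φ n)) f] with x hx hsub
  have h1 := hx.tendsto_atTop_zero
  simp only [hsub, Pi.sub_apply] at h1
  exact tendsto_iff_norm_sub_tendsto_zero.2 h1

theorem ZeroTendsto.comp {u : ℕ → X →ₘ[μ] ℝ} {f : X →ₘ[μ] ℝ} (h : ZeroTendsto μ u f)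
    {φ : ℕ → ℕ} (hφ : Tendsto φ atTop atTop) : ZeroTendsto μ (fun n => u (φ n)) f := by
  unfold ZeroTendsto at *
  exact h.comp hφ

/-- Completeness of `L⁰`, for series. -/
theorem exists_zeroTendsto_sum {f : ℕ → X →ₘ[μ] ℝ} (h : ∑' n, zeroNorm μ (f n) ≠ ⊤) :
    ∃ g, ZeroTendsto μ (fun n => ∑ i ∈ Finset.range n, f i) g := by
  have hsum : ∀ n, ∀ᵐ x ∂μ,
      (∑ i ∈ Finset.range n, f i : X →ₘ[μ] ℝ) x = ∑ i ∈ Finset.range n, f i x := by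
    intro n
    induction n with
    | zero =>
      filter_upwards [AEEqFun.coeFn_zero (μ := μ) (β := ℝ)] with x hx
      simpa using hx
    | succ n ih =>
      simp only [Finset.sum_range_succ]
      filter_upwards [ih, AEEqFun.coeFn_add (∑ i ∈ Finset.range n, f i) (f n)] with x h1 h2
      rw [h2, Pi.add_apply, h1]
  have hlim : ∀ᵐ x ∂μ, Tendsto (fun n => (∑ i ∈ Finset.range n, f i : X →ₘ[μ] ℝ) x) atTop
      (𝓝 (∑' i, f i x)) := by
    filter_upwards [ae_summable_of_tsum_zeroNorm h, ae_all_iff.2 hsum] with x h1 h2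
    simp only [h2]
    exact h1.of_norm.hasSum.tendsto_sum_nat
  have hm : AEStronglyMeasurable (fun x => ∑' i, f i x) μ :=
    aestronglyMeasurable_of_tendsto_ae atTop (fun n => AEEqFun.aestronglyMeasurable _) hlim
  refine ⟨AEEqFun.mk _ hm, zeroTendsto_of_ae ?_⟩
  filter_upwards [hlim, AEEqFun.coeFn_mk _ hm] with x h1 h2
  rwa [h2]

theorem ZeroTendsto.zeroNorm_le {u : ℕ → X →ₘ[μ] ℝ} {f : X →ₘ[μ] ℝ} (h : ZeroTendsto μ u f)
    {C : ℝ≥0∞} (hC : ∀ n, zeroNorm μ (u n) ≤ C) : zeroNorm μ f ≤ C := by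
  have h1 : Tendsto (fun n => zeroNorm μ (u n - f) + C) atTop (𝓝 (0 + C)) := h.add_const C
  rw [zero_add] at h1
  refine ge_of_tendsto' h1 fun n => ?_
  have h2 := zeroNorm_add_le μ (f - u n) (u n)
  rw [sub_add_cancel, ← zeroNorm_neg μ (f - u n), neg_sub] at h2
  exact h2.trans (by gcongr; exact hC n)

theorem ZeroTendsto.of_close {u v : ℕ → X →ₘ[μ] ℝ} {f : X →ₘ[μ] ℝ} (hu : ZeroTendsto μ u f)
    (h : Tendsto (fun n => zeroNorm μ (v n - u n)) atTop (𝓝 0)) : ZeroTendsto μ v f := by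
  have h1 := h.add hu
  rw [add_zero] at h1
  refine tendsto_of_tendsto_of_tendsto_of_le_of_le tendsto_const_nhds h1
    (fun _ => bot_le) fun n => ?_
  change zeroNorm μ (v n - f) ≤ _
  rw [← sub_add_sub_cancel (v n) (u n) f]
  exact zeroNorm_add_le μ _ _

theorem tendsto_zeroNorm_smul (f : X →ₘ[μ] ℝ) {c : ℕ → ℝ} (hc : Tendsto c atTop (𝓝 0)) :
    Tendsto (fun n => zeroNorm μ (c n • f)) atTop (𝓝 0) := by
  have h : ZeroTendsto μ (fun n => c n • f) 0 := by
    refine zeroTendsto_of_ae ?_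
    filter_upwards [ae_all_iff.2 fun n => AEEqFun.coeFn_smul (c n) f,
      AEEqFun.coeFn_zero (μ := μ) (β := ℝ)] with x h1 h2
    simpa [h1, h2] using hc.mul_const (f x)
  simpa [ZeroTendsto] using h

end LocalConvergence

namespace L2Form

/-! ### Properties of the extended form -/

section ExtendedForm

variable {μ : Measure X} {q : L2Form μ}

theorem form_add_add_form_sub (u v : q.domain) :
    q.form (u + v) + q.form (u - v) = 2 * q.form u + 2 * q.form v := by
  have h1 : q.form (u + v) = q.form u + q.form v + QuadraticMap.polar q.form u v := by
    simp [QuadraticMap.polar]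
  have h2 : q.form (u + -v) = q.form u + q.form (-v) + QuadraticMap.polar q.form u (-v) := by
    simp [QuadraticMap.polar]
  rw [QuadraticMap.map_neg, QuadraticMap.polar_neg_right] at h2
  rw [h1, sub_eq_add_neg, h2]
  ring

theorem form_smul (c : ℝ) (u : q.domain) : q.form (c • u) = c ^ 2 * q.form u := by
  rw [QuadraticMap.map_smul, smul_eq_mul, sq]

/-- Balls around `f x` are convex. One null set serves all radii, so that a.e. convergence of a
sequence passes to convex combinations of its tails. -/
theorem abs_sub_le_of_mem_convexHull {u : ℕ → q.domain} (f : X →ₘ[μ] ℝ) {s : Set ℕ}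
    {v : q.domain} (hv : v ∈ convexHull ℝ (u '' s)) :
    ∀ᵐ x ∂μ, ∀ r : ℝ, (∀ k ∈ s, |(u k : Lp ℝ 2 μ) x - f x| ≤ r) →
      |(v : Lp ℝ 2 μ) x - f x| ≤ r := by
  have hconv : Convex ℝ {v : q.domain | ∀ᵐ x ∂μ, ∀ r : ℝ,
      (∀ k ∈ s, |(u k : Lp ℝ 2 μ) x - f x| ≤ r) → |(v : Lp ℝ 2 μ) x - f x| ≤ r} := by
    intro v hv w hw a b ha hb hab
    filter_upwards [hv, hw, Lp.coeFn_add (a • (v : Lp ℝ 2 μ)) (b • (w : Lp ℝ 2 μ)),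
      Lp.coeFn_smul a (v : Lp ℝ 2 μ), Lp.coeFn_smul b (w : Lp ℝ 2 μ)] with x h1 h2 h3 h4 h5 r hr
    rw [Submodule.coe_add, Submodule.coe_smul, Submodule.coe_smul, h3, Pi.add_apply, h4, h5]
    have h6 := h1 r hr
    have h7 := h2 r hr
    rw [← Real.dist_eq, ← Metric.mem_closedBall] at h6 h7 ⊢
    exact convex_closedBall (f x) r h6 h7 ha hb hab
  refine convexHull_min ?_ hconv hv
  rintro _ ⟨k, hk, rfl⟩
  rw [Set.mem_ofPred_eq]
  filter_upwards with x r hr using hr k hk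

/-- The minimum is `(u + v - |u - v|) / 2`. The parallelogram law, used for `u + v` and `|u - v|`
and then for `u` and `v`, gives the bound once `q(|u - v|) ≤ q(u - v)`. -/
theorem exists_form_le_ae_eq_min (hBD : q.FirstBeurlingDeny) (u v : q.domain) :
    ∃ w : q.domain, q.form w ≤ q.form u + q.form v ∧
      ∀ᵐ x ∂μ, (w : Lp ℝ 2 μ) x = min ((u : Lp ℝ 2 μ) x) ((v : Lp ℝ 2 μ) x) := by
  have habs : ∃ a : q.domain, (a : Lp ℝ 2 μ) = |(u : Lp ℝ 2 μ) - v| ∧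
      q.form a ≤ q.form (u - v) := by
    -- The value is `∞` off the domain, so the criterion also places `|u - v|` in the domain.
    have h := hBD ((u - v : q.domain) : Lp ℝ 2 μ)
    unfold value at h
    rw [dif_pos (u - v).2] at h
    split_ifs at h with hmem
    · exact ⟨⟨_, hmem⟩, rfl, (ENNReal.ofReal_le_ofReal_iff (q.nonneg _)).1 h⟩
    · exact absurd h (by simp)
  obtain ⟨a, ha, hform⟩ := habs
  refine ⟨(1 / 2 : ℝ) • ((u + v) - a), ?_, ?_⟩
  · have h1 := form_add_add_form_sub (u + v) a
    have h2 := form_add_add_form_sub u v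
    have h3 := q.nonneg (u + v + a)
    rw [form_smul]
    linarith
  · rw [Submodule.coe_smul, Submodule.coe_sub, Submodule.coe_add, ha]
    obtain ⟨u, -⟩ := u
    obtain ⟨v, -⟩ := v
    filter_upwards [Lp.coeFn_smul (1 / 2 : ℝ) (u + v - |u - v|), Lp.coeFn_sub (u + v) |u - v|,
      Lp.coeFn_add u v, Lp.coeFn_abs (u - v), Lp.coeFn_sub u v] with x h1 h2 h3 h4 h5
    rw [h1, Pi.smul_apply, h2, Pi.sub_apply, h3, h4, h5, Pi.add_apply, Pi.sub_apply, smul_eq_mul]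
    rcases le_total (u x) (v x) with h | h
    · rw [min_eq_left h, abs_of_nonpos (sub_nonpos.2 h)]
      ring
    · rw [min_eq_right h, abs_of_nonneg (sub_nonneg.2 h)]
      ring

variable [SigmaFinite μ]

theorem exists_form_lt {f : X →ₘ[μ] ℝ} {C : ℝ≥0∞} (h : q.ext f < C) {ε : ℝ≥0∞} (hε : 0 < ε) :
    ∃ u : q.domain, ENNReal.ofReal (q.form u) < C ∧
      zeroNorm μ (((u : Lp ℝ 2 μ) : X →ₘ[μ] ℝ) - f) < ε := by
  obtain ⟨c, ⟨u, hu, hc⟩, hcC⟩ := sInf_lt_iff.1 h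
  have h1 : Tendsto (fun n => zeroNorm μ (((u n : Lp ℝ 2 μ) : X →ₘ[μ] ℝ) - f)) atTop (𝓝 0) :=
    hu.2
  obtain ⟨n, hn, hn'⟩ := ((hc.eventually_lt_const hcC).and (h1.eventually_lt_const hε)).exists
  exact ⟨u n, hn, hn'⟩

/-- Fatou property of the extended form along sequences in the domain of the form. -/
theorem ext_le_of_form_le {u : ℕ → q.domain} {f : X →ₘ[μ] ℝ} {C : ℝ}
    (hC : ∀ n, q.form (u n) ≤ C)
    (hu : ZeroTendsto μ (fun n => ((u n : Lp ℝ 2 μ) : X →ₘ[μ] ℝ)) f) :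
    q.ext f ≤ ENNReal.ofReal C := by
  obtain ⟨φ, -, hae⟩ := hu.exists_seq_ae
  -- Almost minimizers of `q` over the convex hulls of the tails are automatically `q`-Cauchy, which
  -- the given sequence need not be, and they have the same limit a.e.
  set T : ℕ → Set q.domain := fun n => convexHull ℝ ((fun k => u (φ k)) '' Set.Ici n) with hT
  set d : ℕ → ℝ := fun n => sInf (q.form '' T n) with hd
  have hmemT : ∀ n, u (φ n) ∈ T n := fun n =>
    subset_convexHull ℝ _ ⟨n, Set.mem_Ici.2 le_rfl, rfl⟩
  have hbdd : ∀ n, BddBelow (q.form '' T n) := by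
    rintro n
    refine ⟨0, ?_⟩
    rintro _ ⟨v, -, rfl⟩
    exact q.nonneg v
  have hdle : ∀ n, ∀ v ∈ T n, d n ≤ q.form v := fun n v hv =>
    csInf_le (hbdd n) ⟨v, hv, rfl⟩
  have hTanti : Antitone T := fun n m hnm =>
    convexHull_mono (Set.image_mono (Set.Ici_subset_Ici.2 hnm))
  have hdmono : Monotone d := fun n m hnm =>
    csInf_le_csInf (hbdd n) ⟨_, _, hmemT m, rfl⟩ (Set.image_mono (hTanti hnm))
  have hdC : ∀ n, d n ≤ C := fun n => (hdle n _ (hmemT n)).trans (hC _)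
  have hex : ∀ n : ℕ, ∃ v ∈ T n, q.form v < d n + 1 / ((n : ℝ) + 1) := by
    intro n
    obtain ⟨_, ⟨v, hv, rfl⟩, hlt⟩ := exists_lt_of_csInf_lt
      (show (q.form '' T n).Nonempty from ⟨_, _, hmemT n, rfl⟩)
      (show sInf (q.form '' T n) < d n + 1 / ((n : ℝ) + 1) from
        lt_add_of_pos_right _ (by positivity))
    exact ⟨v, hv, hlt⟩
  choose v hvT hv using hex
  have hbddA : BddAbove (Set.range d) := by
    refine ⟨C, ?_⟩
    rintro _ ⟨n, rfl⟩
    exact hdC n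
  have hlim : Tendsto d atTop (𝓝 (⨆ n, d n)) := tendsto_atTop_ciSup hdmono hbddA
  have hdist : ∀ n m, n ≤ m →
      q.form (v n - v m) ≤ 2 * ((⨆ n, d n) - d n) + 4 * (1 / ((n : ℝ) + 1)) := by
    intro n m hnm
    have h1 := form_add_add_form_sub (v n) (v m)
    -- The midpoint stays in `T n`, so its form is at least `d n`; the parallelogram law then leaves
    -- little room for `q (v n - v m)`.
    have hmid : (1 / 2 : ℝ) • (v n + v m) ∈ T n := by
      rw [smul_add]
      exact convex_convexHull ℝ _ (hvT n) (hTanti hnm (hvT m)) (by norm_num) (by norm_num)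
        (by norm_num)
    have h2 := hdle n _ hmid
    rw [form_smul] at h2
    have h3 := hv n
    have h4 := hv m
    have h5 : 1 / ((m : ℝ) + 1) ≤ 1 / ((n : ℝ) + 1) := by gcongr
    have h6 : d m ≤ ⨆ n, d n := le_ciSup hbddA m
    linarith
  have htail : Tendsto (fun n : ℕ => 2 * ((⨆ n, d n) - d n) + 4 * (1 / ((n : ℝ) + 1))) atTop
      (𝓝 0) := by
    have h1 := ((tendsto_const_nhds (x := ⨆ n, d n)).sub hlim).const_mul 2
    have h2 := (tendsto_one_div_add_atTop_nhds_zero_nat (𝕜 := ℝ)).const_mul 4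
    simpa using h1.add h2
  have hcauchy : q.IsFormCauchy v := by
    intro ε hε
    obtain ⟨N, hN⟩ := eventually_atTop.1 (htail.eventually_lt_const hε)
    refine ⟨N, fun m hm n hn => ?_⟩
    rcases le_total m n with h | h
    · exact (hdist m n h).trans_lt (hN m hm)
    · rw [← QuadraticMap.map_neg, neg_sub]
      exact (hdist n m h).trans_lt (hN n hn)
  have hform : Tendsto (fun n => q.form (v n)) atTop (𝓝 (⨆ n, d n)) := by
    have h2 := hlim.add (tendsto_one_div_add_atTop_nhds_zero_nat (𝕜 := ℝ))
    rw [add_zero] at h2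
    exact tendsto_of_tendsto_of_tendsto_of_le_of_le hlim h2 (fun n => hdle n _ (hvT n))
      fun n => (hv n).le
  have hzero : ZeroTendsto μ (fun n => ((v n : Lp ℝ 2 μ) : X →ₘ[μ] ℝ)) f := by
    refine zeroTendsto_of_ae ?_
    filter_upwards [hae, ae_all_iff.2 fun n => abs_sub_le_of_mem_convexHull f (hvT n)]
      with x h1 h2
    rw [Metric.tendsto_atTop] at h1 ⊢
    intro ε hε
    obtain ⟨N, hN⟩ := h1 (ε / 2) (by positivity)
    refine ⟨N, fun n hn => ?_⟩
    rw [Real.dist_eq]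
    refine (h2 n (ε / 2) fun k hk => ?_).trans_lt (by linarith)
    rw [← Real.dist_eq]
    exact (hN k (hn.trans hk)).le
  refine (sInf_le ⟨v, ⟨hcauchy, hzero⟩, ENNReal.tendsto_ofReal hform⟩ :
    q.ext f ≤ ENNReal.ofReal (⨆ n, d n)).trans (ENNReal.ofReal_le_ofReal (ciSup_le hdC))

theorem exists_seq_form_le {f : X →ₘ[μ] ℝ} {C : ℝ≥0∞} (h : q.ext f < C) :
    ∃ u : ℕ → q.domain, (∀ n, ENNReal.ofReal (q.form (u n)) ≤ C) ∧
      ZeroTendsto μ (fun n => ((u n : Lp ℝ 2 μ) : X →ₘ[μ] ℝ)) f := by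
  choose u hu hu' using fun n : ℕ => exists_form_lt h (ε := ((n : ℝ≥0∞))⁻¹) (by simp)
  exact ⟨u, fun n => (hu n).le, tendsto_of_tendsto_of_tendsto_of_le_of_le tendsto_const_nhds
    ENNReal.tendsto_inv_nat_nhds_zero (fun _ => bot_le) fun n => (hu' n).le⟩

theorem ext_le_of_ofReal_form_le {u : ℕ → q.domain} {f : X →ₘ[μ] ℝ} {C : ℝ≥0∞}
    (hC : ∀ n, ENNReal.ofReal (q.form (u n)) ≤ C)
    (hu : ZeroTendsto μ (fun n => ((u n : Lp ℝ 2 μ) : X →ₘ[μ] ℝ)) f) : q.ext f ≤ C := by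
  rcases eq_or_ne C ⊤ with rfl | hCtop
  · exact le_top
  · rw [← ENNReal.ofReal_toReal hCtop]
    exact ext_le_of_form_le (fun n => (ENNReal.ofReal_le_iff_le_toReal hCtop).1 (hC n)) hu

/-- The extended form is lower semicontinuous. -/
theorem ext_le_of_zeroTendsto {u : ℕ → X →ₘ[μ] ℝ} {f : X →ₘ[μ] ℝ} {C : ℝ≥0∞}
    (hC : ∀ n, q.ext (u n) ≤ C) (hu : ZeroTendsto μ u f) : q.ext f ≤ C := by
  refine le_of_forall_gt_imp_ge_of_dense fun D hD => ?_
  choose v hv hv' using fun n : ℕ =>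
    exists_form_lt ((hC n).trans_lt hD) (ε := ((n : ℝ≥0∞))⁻¹) (by simp)
  refine ext_le_of_ofReal_form_le (fun n => (hv n).le) (hu.of_close ?_)
  exact tendsto_of_tendsto_of_tendsto_of_le_of_le tendsto_const_nhds
    ENNReal.tendsto_inv_nat_nhds_zero (fun _ => bot_le) fun n => (hv' n).le

theorem ext_neg (f : X →ₘ[μ] ℝ) : q.ext (-f) = q.ext f := by
  have key : ∀ f : X →ₘ[μ] ℝ, q.ext (-f) ≤ q.ext f := by
    intro f
    refine le_of_forall_gt_imp_ge_of_dense fun D hD => ?_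
    obtain ⟨u, hu, hu'⟩ := exists_seq_form_le hD
    refine ext_le_of_ofReal_form_le (u := fun n => -u n) (fun n => ?_) ?_
    · rw [QuadraticMap.map_neg]
      exact hu n
    · refine hu'.congr fun n => ?_
      rw [← zeroNorm_neg]
      congr 1
      simp only [NegMemClass.coe_neg]
      abel
  refine le_antisymm (key f) ?_
  simpa using key (-f)

/-- The minima of approximating sequences need not be `q`-Cauchy, but their forms are bounded, which
suffices by the Fatou property. -/
theorem ext_inf_le (hBD : q.FirstBeurlingDeny) (f g : X →ₘ[μ] ℝ) :
    q.ext (f ⊓ g) ≤ q.ext f + q.ext g := by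
  refine ENNReal.le_of_forall_pos_le_add fun ε hε hlt => ?_
  have hε' : (ε / 2 : ℝ≥0∞) ≠ 0 := by simpa using hε.ne'
  have hlt' := ENNReal.add_lt_top.1 hlt
  obtain ⟨u, hu, hu'⟩ := exists_seq_form_le (ENNReal.lt_add_right hlt'.1.ne hε')
  obtain ⟨v, hv, hv'⟩ := exists_seq_form_le (ENNReal.lt_add_right hlt'.2.ne hε')
  choose w hw hw' using fun n => exists_form_le_ae_eq_min hBD (u n) (v n)
  refine ext_le_of_ofReal_form_le (u := w) (fun n => ?_) ?_
  · calc ENNReal.ofReal (q.form (w n)) ≤ ENNReal.ofReal (q.form (u n) + q.form (v n)) :=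
          ENNReal.ofReal_le_ofReal (hw n)
      _ = ENNReal.ofReal (q.form (u n)) + ENNReal.ofReal (q.form (v n)) :=
          ENNReal.ofReal_add (q.nonneg _) (q.nonneg _)
      _ ≤ (q.ext f + ε / 2) + (q.ext g + ε / 2) := add_le_add (hu n) (hv n)
      _ = q.ext f + q.ext g + ε := by rw [add_add_add_comm, ENNReal.add_halves]
  · have h := Tendsto.add hu' hv'
    rw [add_zero] at h
    refine tendsto_of_tendsto_of_tendsto_of_le_of_le tendsto_const_nhds h
      (fun _ => bot_le) fun n => zeroNorm_le_add_of_ae ?_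
    filter_upwards [hw' n, AEEqFun.coeFn_inf f g,
      AEEqFun.coeFn_sub ((w n : Lp ℝ 2 μ) : X →ₘ[μ] ℝ) (f ⊓ g),
      AEEqFun.coeFn_sub ((u n : Lp ℝ 2 μ) : X →ₘ[μ] ℝ) f,
      AEEqFun.coeFn_sub ((v n : Lp ℝ 2 μ) : X →ₘ[μ] ℝ) g] with x h1 h2 h3 h4 h5
    rw [h3, h4, h5, Pi.sub_apply, Pi.sub_apply, Pi.sub_apply, h1, h2]
    exact (abs_min_sub_min_le_max _ _ _ _).trans
      (max_le_add_of_nonneg (abs_nonneg _) (abs_nonneg _))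

/-- The truncation of `f` at the levels `-h` and `h`. -/
theorem ext_clip_le (hBD : q.FirstBeurlingDeny) {h : X →ₘ[μ] ℝ} (hh : q.ext h = 0)
    (f : X →ₘ[μ] ℝ) : q.ext (-(-(f ⊓ h) ⊓ h)) ≤ q.ext f := by
  rw [ext_neg]
  refine (ext_inf_le hBD _ _).trans ?_
  rw [ext_neg, hh, add_zero]
  refine (ext_inf_le hBD _ _).trans ?_
  rw [hh, add_zero]

/-! ### The seminorm of the extended form and its parallelogram law -/

theorem extSeminorm_eq (f : q.extDomain) : q.extSeminorm f = √(q.ext f).toReal := rfl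

theorem extSeminorm_sq (f : q.extDomain) : q.extSeminorm f ^ 2 = (q.ext f).toReal :=
  Real.sq_sqrt ENNReal.toReal_nonneg

theorem ext_eq_ofReal (f : q.extDomain) : q.ext f = ENNReal.ofReal (q.extSeminorm f ^ 2) := by
  rw [extSeminorm_sq, ENNReal.ofReal_toReal (ne_of_lt f.2)]

theorem extSeminorm_add_eq_left (f k : q.extDomain) (hk : q.extSeminorm k = 0) :
    q.extSeminorm (f + k) = q.extSeminorm f := by
  have h1 := map_add_le_add q.extSeminorm f k
  have h2 := map_sub_le_add q.extSeminorm (f + k) k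
  rw [add_sub_cancel_right] at h2
  linarith

/-- Sums and differences of approximating sequences approximate `f + g` and `f - g`, and the law for
`q` passes to the limit. Since `ext` is an infimum, the sequences are chosen with slack `ε`, and
only an inequality results; applying it to `f + g` and `f - g` yields the reverse one. -/
theorem extSeminorm_parallelogram_le (f g : q.extDomain) :
    q.extSeminorm (f + g) ^ 2 + q.extSeminorm (f - g) ^ 2 ≤
      2 * q.extSeminorm f ^ 2 + 2 * q.extSeminorm g ^ 2 := by
  have key : ∀ ε : ℝ, 0 < ε → q.extSeminorm (f + g) ^ 2 + q.extSeminorm (f - g) ^ 2 ≤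
      2 * (q.extSeminorm f + ε) ^ 2 + 2 * (q.extSeminorm g + ε) ^ 2 := by
    intro ε hε
    have hpf := apply_nonneg q.extSeminorm f
    have hpg := apply_nonneg q.extSeminorm g
    obtain ⟨u, hu, l, hl, hle⟩ := exists_approx (a := q.extSeminorm f + ε) (by positivity)
      (lt_ofReal_sq f.2 (by rw [← extSeminorm_eq]; linarith))
    obtain ⟨v, hv, k, hk, hke⟩ := exists_approx (a := q.extSeminorm g + ε) (by positivity)
      (lt_ofReal_sq g.2 (by rw [← extSeminorm_eq]; linarith))
    have hadd := hu.add hv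
    have hsub := hu.add (hv.smul (-1))
    obtain ⟨a, ha⟩ := hadd.1.exists_tendsto
    obtain ⟨b, hb⟩ := hsub.1.exists_tendsto
    have ha0 : 0 ≤ a := ge_of_tendsto' ha fun n => apply_nonneg _ _
    have hb0 : 0 ≤ b := ge_of_tendsto' hb fun n => apply_nonneg _ _
    have hl0 : 0 ≤ l := ge_of_tendsto' hl fun n => apply_nonneg _ _
    have hk0 : 0 ≤ k := ge_of_tendsto' hk fun n => apply_nonneg _ _
    have h1 : q.extSeminorm (f + g) ≤ a :=
      sqrt_le_of_ext_le ha0 (ext_le hadd fun j hj => (tendsto_nhds_unique hj ha).le)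
    have h2 : q.extSeminorm (f - g) ≤ b := by
      refine sqrt_le_of_ext_le hb0 ?_
      have : ((f - g : q.extDomain) : X →ₘ[μ] ℝ) = f + (-1 : ℝ) • (g : X →ₘ[μ] ℝ) := by
        rw [Submodule.coe_sub, neg_smul, one_smul, sub_eq_add_neg]
      rw [this]
      exact ext_le hsub fun j hj => (tendsto_nhds_unique hj hb).le
    have h3 : a ^ 2 + b ^ 2 = 2 * l ^ 2 + 2 * k ^ 2 := by
      refine tendsto_nhds_unique ((ha.pow 2).add (hb.pow 2))
        ((((hl.pow 2).const_mul 2).add ((hk.pow 2).const_mul 2)).congr fun n => ?_)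
      have h := form_add_add_form_sub (u n) (v n)
      rw [sub_eq_add_neg, ← neg_one_smul ℝ (v n)] at h
      simp only [seminorm_sq]
      exact h.symm
    have h4 := pow_le_pow_left₀ (apply_nonneg _ _) h1 2
    have h5 := pow_le_pow_left₀ (apply_nonneg _ _) h2 2
    have h6 := pow_le_pow_left₀ hl0 hle 2
    have h7 := pow_le_pow_left₀ hk0 hke 2
    linarith
  have hcont : Continuous fun ε : ℝ =>
      2 * (q.extSeminorm f + ε) ^ 2 + 2 * (q.extSeminorm g + ε) ^ 2 := by fun_prop
  have h := (hcont.tendsto 0).mono_left (nhdsWithin_le_nhds (s := Set.Ioi 0))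
  simp only [add_zero] at h
  exact ge_of_tendsto h (eventually_mem_nhdsWithin.mono fun ε hε => key ε hε)

theorem extSeminorm_parallelogram (f g : q.extDomain) :
    q.extSeminorm (f + g) ^ 2 + q.extSeminorm (f - g) ^ 2 =
      2 * q.extSeminorm f ^ 2 + 2 * q.extSeminorm g ^ 2 := by
  refine le_antisymm (extSeminorm_parallelogram_le f g) ?_
  have h := extSeminorm_parallelogram_le (f + g) (f - g)
  have h1 : f + g + (f - g) = (2 : ℝ) • f := by rw [two_smul]; abel
  have h2 : f + g - (f - g) = (2 : ℝ) • g := by rw [two_smul]; abel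
  rw [h1, h2, map_smul_eq_mul, map_smul_eq_mul, Real.norm_ofNat] at h
  linarith

end ExtendedForm
end L2Form

/-! ### Countably subadditive functions on complete seminormed spaces -/

section CountablySubadditive

variable {E : Type*} [SeminormedAddCommGroup E] [NormedSpace ℝ E] [CompleteSpace E] {N : E → ℝ≥0∞}

/-- By `hscale` the dilates of `{N ≤ ε / 2}` cover the space, so by Baire the closure of one of them
has an interior point; differences then fill, up to closure, a ball around `0`. -/
theorem exists_delta_forall_exists_near (hneg : ∀ x, N (-x) = N x)
    (hadd : ∀ x y, N (x + y) ≤ N x + N y)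
    (hscale : ∀ x, Tendsto (fun n : ℕ => N (((n : ℝ) + 1)⁻¹ • x)) atTop (𝓝 0))
    {ε : ℝ≥0∞} (hε : 0 < ε) :
    ∃ δ : ℝ, 0 < δ ∧ ∀ x, ‖x‖ < δ → ∀ η : ℝ, 0 < η → ∃ y, N y ≤ ε ∧ ‖x - y‖ < η := by
  set F : ℕ → Set E := fun n => closure ((fun x => ((n : ℝ) + 1) • x) '' {x | N x ≤ ε / 2})
  have hF : ⋃ n, F n = Set.univ := by
    refine Set.eq_univ_of_forall fun x => ?_
    obtain ⟨n, hn⟩ := ((hscale x).eventually_le_const (ENNReal.half_pos hε.ne')).exists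
    exact Set.mem_iUnion.2 ⟨n, subset_closure ⟨_, hn, smul_inv_smul₀ (by positivity) x⟩⟩
  obtain ⟨n, x₀, hx₀⟩ := nonempty_interior_of_iUnion_of_closed (f := F)
    (fun n => isClosed_closure) hF
  obtain ⟨ρ, hρ, hball⟩ := Metric.isOpen_iff.1 isOpen_interior x₀ hx₀
  have hn : (0 : ℝ) < (n : ℝ) + 1 := by positivity
  refine ⟨ρ / (n + 1), by positivity, fun x hx η hη => ?_⟩
  -- Both `x₀` and `x₀ + (n + 1) x` are close to dilates `(n + 1) a` and `(n + 1) b` of points with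
  -- `N ≤ ε / 2`, so `b - a` is close to `x`.
  have h1 : x₀ + ((n : ℝ) + 1) • x ∈ F n := by
    refine interior_subset (hball ?_)
    rw [mem_ball_iff_norm, add_sub_cancel_left, norm_smul, Real.norm_of_nonneg hn.le]
    rwa [lt_div_iff₀' hn] at hx
  obtain ⟨_, ⟨a, ha, rfl⟩, ha'⟩ := Metric.mem_closure_iff.1 (interior_subset hx₀) (η / 2)
    (by positivity)
  obtain ⟨_, ⟨b, hb, rfl⟩, hb'⟩ := Metric.mem_closure_iff.1 h1 (η / 2) (by positivity)
  refine ⟨b - a, ?_, ?_⟩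
  · rw [sub_eq_add_neg]
    refine (hadd _ _).trans ?_
    rw [hneg, ← ENNReal.add_halves ε]
    exact add_le_add hb ha
  · rw [dist_eq_norm] at ha' hb'
    have h2 : ((n : ℝ) + 1) • (x - (b - a)) =
        (x₀ + ((n : ℝ) + 1) • x - ((n : ℝ) + 1) • b) - (x₀ - ((n : ℝ) + 1) • a) := by
      simp only [smul_sub]
      abel
    have h3 := norm_sub_le (x₀ + ((n : ℝ) + 1) • x - ((n : ℝ) + 1) • b) (x₀ - ((n : ℝ) + 1) • a)
    rw [← h2, norm_smul, Real.norm_of_nonneg hn.le] at h3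
    have h4 : (0 : ℝ) ≤ n := n.cast_nonneg
    nlinarith [norm_nonneg (x - (b - a))]

/-- A countably subadditive function on a complete seminormed space that is small on small
multiples of every vector is small on a ball. -/
theorem exists_delta_of_countably_subadditive (hneg : ∀ x, N (-x) = N x)
    (hadd : ∀ x y, N (x + y) ≤ N x + N y)
    (hscale : ∀ x, Tendsto (fun n : ℕ => N (((n : ℝ) + 1)⁻¹ • x)) atTop (𝓝 0))
    (hsum : ∀ (u : ℕ → E) (x : E),
      Tendsto (fun n => ∑ i ∈ Finset.range n, u i) atTop (𝓝 x) → N x ≤ ∑' i, N (u i))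
    {ε : ℝ≥0∞} (hε : 0 < ε) : ∃ δ : ℝ, 0 < δ ∧ ∀ x, ‖x‖ < δ → N x < ε := by
  obtain ⟨e, he, hesum⟩ := ENNReal.exists_pos_sum_of_countable hε.ne' ℕ
  choose δ hδ hnear using fun k => exists_delta_forall_exists_near hneg hadd hscale
    (ε := (e k : ℝ≥0∞)) (by simpa using he k)
  have hex : ∀ k x, ∃ y, ‖x‖ < δ k →
      N y ≤ e k ∧ ‖x - y‖ < min (δ (k + 1)) (1 / ((k : ℝ) + 1)) := by
    intro k x
    by_cases hx : ‖x‖ < δ k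
    · obtain ⟨y, hy⟩ := hnear k x hx (min (δ (k + 1)) (1 / ((k : ℝ) + 1)))
        (lt_min (hδ (k + 1)) (by positivity))
      exact ⟨y, fun _ => hy⟩
    · exact ⟨0, fun h => absurd h hx⟩
  choose F hF using hex
  refine ⟨δ 0, hδ 0, fun x hx => ?_⟩
  -- Successive remainders: subtracting an approximant with `N ≤ e k` from `r k` lands in the ball
  -- of radius `δ (k + 1)`, so the procedure continues. The bound `1 / (k + 1)` makes the
  -- approximants sum to `x`.
  set r : ℕ → E := fun n => Nat.rec x (fun k y => y - F k y) n with hr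
  have hr0 : r 0 = x := rfl
  have hrs : ∀ k, r (k + 1) = r k - F k (r k) := fun k => rfl
  have hrδ : ∀ k, ‖r k‖ < δ k := by
    intro k
    induction k with
    | zero => exact hx
    | succ k ih => exact (hF k (r k) ih).2.trans_le (min_le_left _ _)
  have hr_lim : Tendsto r atTop (𝓝 0) := by
    refine (tendsto_add_atTop_iff_nat 1).1 (squeeze_zero_norm (fun k => ?_)
      (tendsto_one_div_add_atTop_nhds_zero_nat (𝕜 := ℝ)))
    exact ((hF k (r k) (hrδ k)).2.trans_le (min_le_right _ _)).le
  have hpartial : ∀ n, ∑ i ∈ Finset.range n, F i (r i) = x - r n := by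
    intro n
    rw [← hr0, ← Finset.sum_range_sub' r n]
    exact Finset.sum_congr rfl fun i _ => by rw [hrs]; abel
  refine (hsum (fun i => F i (r i)) x ?_).trans_lt (lt_of_le_of_lt ?_ hesum)
  · simp only [hpartial]
    simpa using hr_lim.const_sub x
  · exact ENNReal.tsum_le_tsum fun k => (hF k (r k) (hrδ k)).1

end CountablySubadditive

theorem completeSpace_iff_of_norm_map {E F : Type*} [SeminormedAddCommGroup E]
    [SeminormedAddCommGroup F] (T : E →+ F) (hT : Function.Surjective T)
    (hnorm : ∀ x, ‖T x‖ = ‖x‖) : CompleteSpace F ↔ CompleteSpace E :=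
  ((AddMonoidHomClass.isometry_of_norm T hnorm).isUniformInducing.completeSpace_congr hT).symm

namespace L2Form

/-! ### The quotients `D(q_e) / ℝ h` and `L⁰ / ℝ h` -/

section Quotients

variable {μ : Measure X} [SigmaFinite μ] {q : L2Form μ}

/-- Completeness of `D(q_e)` for the seminorm `q_e^{1/2}`. -/
def IsExtComplete (q : L2Form μ) : Prop :=
  @CompleteSpace q.extDomain
    q.extSeminorm.toSeminormedAddCommGroup.toPseudoMetricSpace.toUniformSpace

variable {K : Submodule ℝ (X →ₘ[μ] ℝ)}

theorem mem_iff_extSeminorm_eq_zero (hK : {f : X →ₘ[μ] ℝ | q.ext f = 0} = K) (f : q.extDomain) :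
    f ∈ K.comap q.extDomain.subtype ↔ q.extSeminorm f = 0 := by
  have h : (f : X →ₘ[μ] ℝ) ∈ {f : X →ₘ[μ] ℝ | q.ext f = 0} ↔ (f : X →ₘ[μ] ℝ) ∈ K := by
    rw [hK, SetLike.mem_coe]
  rw [Submodule.mem_comap, Submodule.subtype_apply, ← h, Set.mem_ofPred_eq, ext_eq_ofReal]
  rw [ENNReal.ofReal_eq_zero, (sq_nonneg (q.extSeminorm f)).ge_iff_eq',
    pow_eq_zero_iff two_ne_zero]

theorem completeSpace_core_iff (c : InnerProductSpace.Core ℝ (q.ExtQuotient K))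
    (hc : ∀ f : q.extDomain, c.inner (Submodule.Quotient.mk f) (Submodule.Quotient.mk f) =
      (q.ext f).toReal) :
    @CompleteSpace (q.ExtQuotient K)
      c.toNormedAddCommGroup.toPseudoMetricSpace.toUniformSpace ↔ q.IsExtComplete := by
  refine @completeSpace_iff_of_norm_map _ _ q.extSeminorm.toSeminormedAddCommGroup
    c.toNormedAddCommGroup.toSeminormedAddCommGroup
    (Submodule.mkQ (K.comap q.extDomain.subtype)).toAddMonoidHom (Submodule.mkQ_surjective _)
    fun f => ?_
  change √(c.inner (Submodule.Quotient.mk f) (Submodule.Quotient.mk f)) = q.extSeminorm f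
  rw [hc]
  rfl

/-- The seminorm descends to a norm because its null space is exactly `K`, so the choice of
representative is immaterial. The parallelogram law then produces the inner product (Jordan–von
Neumann). -/
theorem exists_core (hK : {f : X →ₘ[μ] ℝ | q.ext f = 0} = K) :
    ∃ c : InnerProductSpace.Core ℝ (q.ExtQuotient K), ∀ f : q.extDomain,
      c.inner (Submodule.Quotient.mk f) (Submodule.Quotient.mk f) = (q.ext f).toReal := by
  set L := K.comap q.extDomain.subtype
  let : Norm (q.ExtQuotient K) := ⟨fun x => q.extSeminorm (Quotient.out x)⟩
  have hnorm : ∀ f : q.extDomain, ‖(Submodule.Quotient.mk f : q.ExtQuotient K)‖ =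
      q.extSeminorm f := by
    intro f
    have h1 : (Submodule.Quotient.mk (Quotient.out (Submodule.Quotient.mk f : q.ExtQuotient K)) :
        q.ExtQuotient K) = Submodule.Quotient.mk f := Quotient.out_eq _
    have h2 := (mem_iff_extSeminorm_eq_zero hK _).1 ((Submodule.Quotient.eq _).1 h1)
    have h3 := extSeminorm_add_eq_left f _ h2
    rw [add_sub_cancel] at h3
    exact h3
  have hcore : NormedSpace.Core ℝ (q.ExtQuotient K) :=
    { norm_nonneg := fun x => apply_nonneg q.extSeminorm _
      norm_smul := fun a x => by
        induction x using Submodule.Quotient.induction_on with | _ f => ?_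
        rw [← Submodule.Quotient.mk_smul, hnorm, hnorm, map_smul_eq_mul]
      norm_triangle := fun x y => by
        induction x using Submodule.Quotient.induction_on with | _ f => ?_
        induction y using Submodule.Quotient.induction_on with | _ g => ?_
        rw [← Submodule.Quotient.mk_add, hnorm, hnorm, hnorm]
        exact map_add_le_add _ f g
      norm_eq_zero_iff := fun x => by
        induction x using Submodule.Quotient.induction_on with | _ f => ?_
        rw [hnorm, Submodule.Quotient.mk_eq_zero, mem_iff_extSeminorm_eq_zero hK] }
  let : NormedAddCommGroup (q.ExtQuotient K) := NormedAddCommGroup.ofCore hcore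
  let : NormedSpace ℝ (q.ExtQuotient K) := NormedSpace.ofCore hcore
  let : InnerProductSpace ℝ (q.ExtQuotient K) := InnerProductSpace.ofNorm ℝ fun x y => by
    induction x using Submodule.Quotient.induction_on with | _ f => ?_
    induction y using Submodule.Quotient.induction_on with | _ g => ?_
    have h := extSeminorm_parallelogram f g
    rw [← hnorm, ← hnorm, ← hnorm, ← hnorm, Submodule.Quotient.mk_add,
      Submodule.Quotient.mk_sub] at h
    linarith
  refine ⟨InnerProductSpace.toCore, fun f => ?_⟩
  rw [← extSeminorm_sq, ← hnorm]
  exact real_inner_self_eq_norm_sq _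

theorem isHilbertQuotient_iff (hK : {f : X →ₘ[μ] ℝ | q.ext f = 0} = K) :
    q.IsHilbertQuotient K ↔ q.IsExtComplete := by
  constructor
  · rintro ⟨c, hc, hcomplete⟩
    exact (completeSpace_core_iff c hc).1 hcomplete
  · intro h
    obtain ⟨c, hc⟩ := exists_core hK
    exact ⟨c, hc, (completeSpace_core_iff c hc).2 h⟩

/-- By translation invariance continuity need only be tested at `0`, and neighbourhoods of `0` in
`L⁰ / ℝ h` are controlled by images of balls in `L⁰`. -/
theorem isContinuousQuotientMap_span_iff (h : X →ₘ[μ] ℝ) :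
    q.IsContinuousQuotientMap (Submodule.span ℝ {h}) ↔
      ∀ ε : ℝ≥0∞, 0 < ε → ∃ δ : ℝ, 0 < δ ∧ ∀ f : q.extDomain, q.extSeminorm f < δ →
        ∃ c : ℝ, zeroNorm μ (f + c • h) < ε := by
  let := zeroPseudoEMetric μ
  let := q.extSeminorm.toSeminormedAddCommGroup
  have hedist : ∀ f g : X →ₘ[μ] ℝ, edist f g = zeroNorm μ (f - g) := fun f g => rfl
  have hnorm : ∀ f g : q.extDomain, dist f g = q.extSeminorm (f - g) := fun f g => by
    rw [dist_eq_norm]; rfl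
  have hmk : ∀ (f : X →ₘ[μ] ℝ) (c : ℝ),
      (Submodule.span ℝ {h}).mkQ (f + c • h) = (Submodule.span ℝ {h}).mkQ f := fun f c => by
    rw [map_add, Submodule.mkQ_apply _ (c • h), (Submodule.Quotient.mk_eq_zero _).2
      (Submodule.smul_mem _ c (Submodule.mem_span_singleton_self h)), add_zero]
  unfold IsContinuousQuotientMap
  rw [continuous_coinduced_dom]
  constructor
  · intro hc ε hε
    -- The image of the `ε`-ball; it is open because its preimage is the union of the translates of
    -- the ball by `ℝ h`.
    set U : Set ((X →ₘ[μ] ℝ) ⧸ Submodule.span ℝ {h}) :=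
      {y | ∃ g, zeroNorm μ g < ε ∧ (Submodule.span ℝ {h}).mkQ g = y}
    have hU : IsOpen[(zeroTopology μ).coinduced (Submodule.mkQ (Submodule.span ℝ {h}))] U := by
      rw [isOpen_coinduced, EMetric.isOpen_iff]
      rintro f ⟨g, hg, hgf⟩
      refine ⟨ε - zeroNorm μ g, tsub_pos_of_lt hg, fun k hk => ⟨g + (k - f), ?_, ?_⟩⟩
      · have h1 : zeroNorm μ (k - f) < ε - zeroNorm μ g := hk
        exact (zeroNorm_add_le μ _ _).trans_lt (lt_tsub_iff_left.1 h1)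
      · rw [map_add, map_sub, hgf]
        abel
    have hV := continuous_def.1 hc U hU
    obtain ⟨δ, hδ, hball⟩ := Metric.isOpen_iff.1 hV 0 ⟨0, by simpa [zeroNorm_zero] using hε, by simp⟩
    refine ⟨δ, hδ, fun f hf => ?_⟩
    obtain ⟨g, hg, hgf⟩ := hball (show f ∈ Metric.ball 0 δ by
      rw [Metric.mem_ball, hnorm, sub_zero]; exact hf)
    have h1 : g - f ∈ Submodule.span ℝ {h} := by
      rw [← Submodule.Quotient.mk_eq_zero, ← Submodule.mkQ_apply, map_sub, hgf]
      exact sub_self _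
    obtain ⟨c, hc⟩ := Submodule.mem_span_singleton.1 h1
    exact ⟨c, by rwa [hc, add_sub_cancel]⟩
  · intro H
    refine continuous_def.2 fun U hU => Metric.isOpen_iff.2 fun f hf => ?_
    rw [isOpen_coinduced, EMetric.isOpen_iff] at hU
    obtain ⟨ε, hε, hball⟩ := hU f hf
    obtain ⟨δ, hδ, hδ'⟩ := H ε hε
    refine ⟨δ, hδ, fun g hg => ?_⟩
    rw [Metric.mem_ball, hnorm] at hg
    obtain ⟨c, hc⟩ := hδ' _ hg
    have h1 : (g : X →ₘ[μ] ℝ) + c • h ∈ (Submodule.span ℝ {h}).mkQ ⁻¹' U := by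
      refine hball ?_
      change zeroNorm μ (g + c • h - f) < ε
      rwa [add_sub_right_comm]
    rw [Set.mem_preimage, hmk] at h1
    exact h1

end Quotients
/-! ### Completeness and continuity -/

section CompletenessContinuity

variable {μ : Measure X} [SigmaFinite μ] {q : L2Form μ} {h : X →ₘ[μ] ℝ}

theorem ext_eq_zero_of_tendsto {u : ℕ → X →ₘ[μ] ℝ} {f : X →ₘ[μ] ℝ}
    (hu : Tendsto (fun n => q.ext (u n)) atTop (𝓝 0)) (huf : ZeroTendsto μ u f) :
    q.ext f = 0 := by
  refine nonpos_iff_eq_zero.1 (le_of_forall_gt_imp_ge_of_dense fun ε hε => ?_)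
  obtain ⟨N, hN⟩ := eventually_atTop.1 (hu.eventually_le_const hε)
  exact ext_le_of_zeroTendsto (u := fun n => u (n + N)) (fun n => hN _ (Nat.le_add_left _ _))
    (huf.comp (tendsto_add_atTop_nat N))

theorem ext_add_smul (hh : q.ext h = 0) (f : q.extDomain) (c : ℝ) :
    q.ext (f + c • h) = ENNReal.ofReal (q.extSeminorm f ^ 2) := by
  have hmem : h ∈ q.extDomain := show q.ext h < ⊤ by simp [hh]
  have h0 : q.extSeminorm (c • ⟨h, hmem⟩) = 0 := by
    rw [map_smul_eq_mul, extSeminorm_eq, hh]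
    simp
  rw [← extSeminorm_add_eq_left f _ h0, ← ext_eq_ofReal]
  rfl

theorem sum_add_smul (u : ℕ → q.extDomain) (c : ℕ → ℝ) (n : ℕ) :
    ∑ i ∈ Finset.range n, ((u i : X →ₘ[μ] ℝ) + c i • h) =
      ((∑ i ∈ Finset.range n, u i : q.extDomain) : X →ₘ[μ] ℝ) +
        (∑ i ∈ Finset.range n, c i) • h := by
  rw [Finset.sum_add_distrib, Finset.sum_smul, Submodule.coe_sum]

/-- The shifts `c n h` make the increments summable in `L⁰` and are invisible to `q_e`, so lower
semicontinuity carries Cauchy estimates to the `L⁰` limit. -/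
theorem isExtComplete_of_continuous (hh : q.ext h = 0)
    (H : ∀ ε : ℝ≥0∞, 0 < ε → ∃ δ : ℝ, 0 < δ ∧ ∀ f : q.extDomain, q.extSeminorm f < δ →
      ∃ c : ℝ, zeroNorm μ (f + c • h) < ε) : q.IsExtComplete := by
  let := q.extSeminorm.toSeminormedAddCommGroup
  have hdist : ∀ f g : q.extDomain, dist f g = q.extSeminorm (f - g) := fun f g => by
    rw [dist_eq_norm]; rfl
  choose δ hδ hδ' using fun n : ℕ => H ((2⁻¹ : ℝ≥0∞) ^ n) (by simp [pos_iff_ne_zero])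
  -- The bound `δ n` provides shifts making the `n`-th increment smaller than `2⁻ⁿ` in `L⁰`; the
  -- bound `1 / (n + 1)` is the final rate of convergence.
  refine Metric.complete_of_convergent_controlled_sequences
    (fun n => min (δ n) (1 / ((n : ℝ) + 1))) (fun n => lt_min (hδ n) (by positivity))
    fun u hu => ?_
  simp only [hdist] at hu
  choose c hc using fun n => hδ' n (u (n + 1) - u n)
    ((hu n (n + 1) n n.le_succ le_rfl).trans_le (min_le_left _ _))
  obtain ⟨g, hg⟩ := exists_zeroTendsto_sum (μ := μ)
    (f := fun n => ((u (n + 1) - u n : q.extDomain) : X →ₘ[μ] ℝ) + c n • h) (by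
      refine ((ENNReal.tsum_le_tsum fun n => (hc n).le).trans_lt ?_).ne
      rw [ENNReal.tsum_geometric, ENNReal.one_sub_inv_two, inv_inv]
      exact ENNReal.ofNat_lt_top)
  simp only [sum_add_smul (fun n => u (n + 1) - u n), Finset.sum_range_sub] at hg
  have hle : ∀ n, q.ext (g + u 0 - u n) ≤
      ENNReal.ofReal ((1 / ((n : ℝ) + 1)) ^ 2) := by
    intro n
    refine ext_le_of_zeroTendsto (u := fun m => ((u (m + n) - u n : q.extDomain) : X →ₘ[μ] ℝ) +
      (∑ i ∈ Finset.range (m + n), c i) • h) (fun m => ?_) ?_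
    · rw [ext_add_smul hh]
      refine ENNReal.ofReal_le_ofReal (pow_le_pow_left₀ (apply_nonneg _ _) ?_ 2)
      exact (hu n (m + n) n (Nat.le_add_left _ _) le_rfl).le.trans (min_le_right _ _)
    · refine (hg.comp (tendsto_add_atTop_nat n)).congr fun m => ?_
      congr 1
      simp only [Submodule.coe_sub]
      abel
  have hmem : g + u 0 ∈ q.extDomain := by
    have h1 : g ∈ q.extDomain := by
      have h2 := hle 0
      rw [add_sub_cancel_right] at h2
      exact h2.trans_lt ENNReal.ofReal_lt_top
    exact add_mem h1 (u 0).2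
  refine ⟨⟨_, hmem⟩, tendsto_iff_dist_tendsto_zero.2 ?_⟩
  refine squeeze_zero (fun _ => dist_nonneg) (fun n => ?_)
    (tendsto_one_div_add_atTop_nhds_zero_nat (𝕜 := ℝ))
  rw [dist_comm, hdist]
  exact sqrt_le_of_ext_le (by positivity) (hle n)

/-- The quotient `F`-norm of `f + ℝ h` in `L⁰ / ℝ h`. -/
def quotientZeroNorm (h f : X →ₘ[μ] ℝ) : ℝ≥0∞ :=
  ⨅ c : ℝ, zeroNorm μ (f + c • h)

theorem quotientZeroNorm_lt_iff {f : X →ₘ[μ] ℝ} {ε : ℝ≥0∞} :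
    quotientZeroNorm h f < ε ↔ ∃ c : ℝ, zeroNorm μ (f + c • h) < ε :=
  iInf_lt_iff

theorem quotientZeroNorm_neg (f : X →ₘ[μ] ℝ) :
    quotientZeroNorm h (-f) = quotientZeroNorm h f := by
  have key : ∀ f : X →ₘ[μ] ℝ, quotientZeroNorm h (-f) ≤ quotientZeroNorm h f := fun f =>
    le_iInf fun c => iInf_le_of_le (-c) (by
      rw [neg_smul, ← neg_add, zeroNorm_neg])
  exact le_antisymm (key f) (by simpa using key (-f))

theorem quotientZeroNorm_add_le (f g : X →ₘ[μ] ℝ) :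
    quotientZeroNorm h (f + g) ≤ quotientZeroNorm h f + quotientZeroNorm h g := by
  unfold quotientZeroNorm
  simp only [ENNReal.iInf_add, ENNReal.add_iInf]
  refine le_iInf₂ fun d c => iInf_le_of_le (c + d) ?_
  rw [add_smul, add_add_add_comm]
  exact zeroNorm_add_le μ _ _

theorem quotientZeroNorm_le (f : X →ₘ[μ] ℝ) : quotientZeroNorm h f ≤ zeroNorm μ f :=
  iInf_le_of_le 0 (by simp)

/-- With nearly optimal shifts the series converges in `L⁰` to some `g`. Since `g - f` is an `L⁰`
limit of elements whose `q_e` tends to `0`, it lies in `ker q_e`, so `g` and `f` agree modulo `ℝ h`.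
-/
theorem quotientZeroNorm_le_tsum (hK : ∀ f, q.ext f = 0 → f ∈ Submodule.span ℝ {h})
    (hh : q.ext h = 0) {u : ℕ → q.extDomain} {f : q.extDomain}
    (hu : Tendsto (fun n => q.extSeminorm (∑ i ∈ Finset.range n, u i - f)) atTop (𝓝 0)) :
    quotientZeroNorm h (f : X →ₘ[μ] ℝ) ≤ ∑' i, quotientZeroNorm h (u i : X →ₘ[μ] ℝ) := by
  refine ENNReal.le_of_forall_pos_le_add fun ε hε hfin => ?_
  obtain ⟨e, he, hesum⟩ := ENNReal.exists_pos_sum_of_countable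
    (ε := (ε : ℝ≥0∞)) (by simpa using hε.ne') ℕ
  choose c hc using fun i => quotientZeroNorm_lt_iff.1 (ENNReal.lt_add_right
    (ENNReal.ne_top_of_tsum_ne_top hfin.ne i) (by simpa using (he i).ne' : (e i : ℝ≥0∞) ≠ 0))
  have hsum : ∑' i, zeroNorm μ ((u i : X →ₘ[μ] ℝ) + c i • h) ≤
      ∑' i, quotientZeroNorm h (u i : X →ₘ[μ] ℝ) + ε :=
    calc _ ≤ ∑' i, (quotientZeroNorm h (u i : X →ₘ[μ] ℝ) + e i) :=
          ENNReal.tsum_le_tsum fun i => (hc i).le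
      _ = ∑' i, quotientZeroNorm h (u i : X →ₘ[μ] ℝ) + ∑' i, (e i : ℝ≥0∞) := ENNReal.tsum_add
      _ ≤ _ := by gcongr
  obtain ⟨g, hg⟩ := exists_zeroTendsto_sum
    (hsum.trans_lt (ENNReal.add_lt_top.2 ⟨hfin, ENNReal.coe_lt_top⟩)).ne
  have hgle := hg.zeroNorm_le fun n =>
    (zeroNorm_sum_le _ _).trans ((ENNReal.sum_le_tsum _).trans hsum)
  refine le_trans ?_ hgle
  have hgf : q.ext (g - f) = 0 := by
    refine ext_eq_zero_of_tendsto (u := fun n =>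
      ((∑ i ∈ Finset.range n, u i - f : q.extDomain) : X →ₘ[μ] ℝ) +
        (∑ i ∈ Finset.range n, c i) • h) ?_ ?_
    · simp only [ext_add_smul hh]
      simpa using ENNReal.tendsto_ofReal (hu.pow 2)
    · refine Tendsto.congr (fun n => ?_) hg
      beta_reduce
      rw [sum_add_smul]
      congr 1
      rw [Submodule.coe_sub]
      abel
  obtain ⟨a, ha⟩ := Submodule.mem_span_singleton.1 (hK _ hgf)
  exact iInf_le_of_le a (by rw [ha, add_sub_cancel])

theorem continuous_of_isExtComplete (hK : ∀ f, q.ext f = 0 → f ∈ Submodule.span ℝ {h})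
    (hh : q.ext h = 0) (hcomplete : q.IsExtComplete) {ε : ℝ≥0∞} (hε : 0 < ε) :
    ∃ δ : ℝ, 0 < δ ∧ ∀ f : q.extDomain, q.extSeminorm f < δ →
      ∃ c : ℝ, zeroNorm μ (f + c • h) < ε := by
  let := q.extSeminorm.toSeminormedAddCommGroup
  let : NormedSpace ℝ q.extDomain :=
    { norm_smul_le := fun a f => (map_smul_eq_mul q.extSeminorm a f).le }
  have : CompleteSpace q.extDomain := hcomplete
  have hscale : ∀ f : q.extDomain, Tendsto (fun n : ℕ =>
      quotientZeroNorm h ((((n : ℝ) + 1)⁻¹ • f : q.extDomain) : X →ₘ[μ] ℝ)) atTop (𝓝 0) := by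
    intro f
    refine tendsto_of_tendsto_of_tendsto_of_le_of_le tendsto_const_nhds
      (tendsto_zeroNorm_smul (f : X →ₘ[μ] ℝ) (c := fun n : ℕ => ((n : ℝ) + 1)⁻¹) ?_)
      (fun _ => bot_le) fun n => quotientZeroNorm_le _
    simpa using tendsto_one_div_add_atTop_nhds_zero_nat (𝕜 := ℝ)
  obtain ⟨δ, hδ, hδ'⟩ := exists_delta_of_countably_subadditive
    (N := fun f : q.extDomain => quotientZeroNorm h (f : X →ₘ[μ] ℝ))
    (fun f => quotientZeroNorm_neg _) (fun f g => quotientZeroNorm_add_le _ _) hscale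
    (fun u f huf => quotientZeroNorm_le_tsum hK hh
      (tendsto_iff_norm_sub_tendsto_zero.1 huf)) hε
  exact ⟨δ, hδ, fun f hf => quotientZeroNorm_lt_iff.1 (hδ' f hf)⟩

end CompletenessContinuity

end L2Form

/-! ### Truncation -/

/-- The truncation of `a` at the levels `-b` and `b`. -/
def clip (a b : ℝ) : ℝ := -(min (-(min a b)) b)

theorem continuous_clip : Continuous fun p : ℝ × ℝ => clip p.1 p.2 := by
  unfold clip
  fun_prop

theorem abs_clip_le {a b : ℝ} (hb : 0 ≤ b) : |clip a b| ≤ b := by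
  unfold clip
  rw [abs_neg, abs_le]
  refine ⟨le_min (neg_le_neg (min_le_right _ _)) (by linarith), min_le_right _ _⟩

theorem clip_eq_right {a b : ℝ} (hb : 0 ≤ b) (h : b ≤ a) : clip a b = b := by
  rw [clip, min_eq_right h, min_eq_left (by linarith), neg_neg]

theorem clip_eq_neg {a b : ℝ} (hb : 0 ≤ b) (h : a ≤ -b) : clip a b = -b := by
  rw [clip, min_eq_left (show a ≤ b by linarith), min_eq_right (show b ≤ -a by linarith)]

theorem clip_eq_left {a b : ℝ} (hb : 0 ≤ b) (h : |clip a b| < b) : clip a b = a := by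
  rcases le_or_gt b a with h1 | h1
  · rw [clip_eq_right hb h1, abs_of_nonneg hb] at h
    exact absurd h (lt_irrefl _)
  · rcases le_or_gt a (-b) with h2 | h2
    · rw [clip_eq_neg hb h2, abs_neg, abs_of_nonneg hb] at h
      exact absurd h (lt_irrefl _)
    · rw [clip, min_eq_left h1.le, min_eq_left (by linarith), neg_neg]

theorem exists_seq_ae_tendsto_zero_of_lintegral {μ : Measure X} {F : ℕ → X → ℝ≥0∞}
    (hF : ∀ n, AEMeasurable (F n) μ) (h : Tendsto (fun n => ∫⁻ x, F n x ∂μ) atTop (𝓝 0)) :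
    ∃ φ : ℕ → ℕ, StrictMono φ ∧ ∀ᵐ x ∂μ, Tendsto (fun n => F (φ n) x) atTop (𝓝 0) := by
  obtain ⟨φ, hφ, hle⟩ := extraction_forall_of_eventually fun n : ℕ =>
    h.eventually_le_const (u := (2⁻¹ : ℝ≥0∞) ^ n) (by simp [pos_iff_ne_zero])
  refine ⟨φ, hφ, ?_⟩
  have hs : ∫⁻ x, ∑' n, F (φ n) x ∂μ ≠ ⊤ := by
    rw [lintegral_tsum fun n => hF _]
    refine ((ENNReal.tsum_le_tsum hle).trans_lt ?_).ne
    rw [ENNReal.tsum_geometric, ENNReal.one_sub_inv_two, inv_inv]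
    exact ENNReal.ofNat_lt_top
  filter_upwards [ae_lt_top' (AEMeasurable.tsum fun n => hF (φ n)) hs] with x hx
  exact ENNReal.tendsto_atTop_zero_of_tsum_ne_top hx.ne

namespace L2Form

/-! ### The weak Poincaré inequality -/

section WeakPoincare

variable {μ : Measure X} {h w : X →ₘ[μ] ℝ}

theorem aestronglyMeasurable_mul_mul {g : X → ℝ} (hg : AEStronglyMeasurable g μ) :
    AEStronglyMeasurable (fun x => g x * h x * w x) μ :=
  (hg.mul h.aestronglyMeasurable).mul w.aestronglyMeasurable

theorem abs_mul_mul_le {a b c : ℝ} (hb : 0 < b) (hc : 0 < c) (ha : |a| ≤ b) :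
    |a * b * c| ≤ c * b ^ 2 := by
  rw [abs_mul, abs_mul, abs_of_pos hb, abs_of_pos hc]
  calc |a| * b * c ≤ b * b * c := by gcongr
    _ = c * b ^ 2 := by ring

theorem sq_mul_le {a b c : ℝ} (hc : 0 < c) (ha : |a| ≤ b) : a ^ 2 * c ≤ c * b ^ 2 := by
  rw [mul_comm, ← sq_abs a]
  gcongr

theorem integrable_sq_mul (hw : IsAdmissibleWeight h w) {g : X →ₘ[μ] ℝ}
    (hg : ∀ᵐ x ∂μ, |g x| ≤ h x) : Integrable (fun x => g x ^ 2 * w x) μ := by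
  refine hw.2.mono' ((g.aestronglyMeasurable.pow 2).mul w.aestronglyMeasurable) ?_
  filter_upwards [hg, hw.1] with x h1 h2
  rw [Real.norm_of_nonneg (by positivity)]
  exact sq_mul_le h2 h1

/-- Every `f` can be shifted by a multiple of `h` in such a way that its truncation becomes
orthogonal to `h`. -/
theorem exists_integral_clip_eq_zero (hh : StrictlyPositive h) (hw : IsAdmissibleWeight h w)
    (f : X →ₘ[μ] ℝ) : ∃ c : ℝ, ∫ x, clip (f x + c * h x) (h x) * h x * w x ∂μ = 0 := by
  have hmeas : ∀ c : ℝ,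
      AEStronglyMeasurable (fun x => clip (f x + c * h x) (h x) * h x * w x) μ := fun c =>
    aestronglyMeasurable_mul_mul (continuous_clip.comp_aestronglyMeasurable
      ((f.aestronglyMeasurable.add (h.aestronglyMeasurable.const_mul c)).prodMk
        h.aestronglyMeasurable))
  have hbound : ∀ c : ℝ, ∀ᵐ x ∂μ,
      ‖clip (f x + c * h x) (h x) * h x * w x‖ ≤ w x * h x ^ 2 := fun c => by
    filter_upwards [hh, hw.1] with x h1 h2
    exact abs_mul_mul_le h1 h2 (abs_clip_le h1.le)
  have hcont : Continuous fun c : ℝ => ∫ x, clip (f x + c * h x) (h x) * h x * w x ∂μ := by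
    refine continuous_of_dominated hmeas hbound hw.2 (Eventually.of_forall fun x => ?_)
    exact ((continuous_clip.comp (by fun_prop : Continuous fun c : ℝ =>
      (f x + c * h x, h x))).mul_const _).mul_const _
  -- If the total mass `∫ w h²` vanishes, so do all the integrals. Otherwise they tend to plus and
  -- minus this mass as `c → ±∞`, and the intermediate value theorem applies.
  by_cases hZ : ∫ x, w x * h x ^ 2 ∂μ ≤ 0
  · exact ⟨0, norm_le_zero_iff.1 ((norm_integral_le_of_norm_le hw.2 (hbound 0)).trans hZ)⟩
  push Not at hZ
  have htop : Tendsto (fun c : ℝ => ∫ x, clip (f x + c * h x) (h x) * h x * w x ∂μ) atTop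
      (𝓝 (∫ x, w x * h x ^ 2 ∂μ)) := by
    refine tendsto_integral_filter_of_dominated_convergence _ (Eventually.of_forall hmeas)
      (Eventually.of_forall hbound) hw.2 ?_
    filter_upwards [hh] with x hx
    refine tendsto_const_nhds.congr' ?_
    filter_upwards [eventually_ge_atTop ((h x - f x) / h x)] with c hc
    rw [div_le_iff₀ hx] at hc
    rw [clip_eq_right hx.le (by linarith)]
    ring
  have hbot : Tendsto (fun c : ℝ => ∫ x, clip (f x + c * h x) (h x) * h x * w x ∂μ) atBot
      (𝓝 (∫ x, -(w x * h x ^ 2) ∂μ)) := by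
    refine tendsto_integral_filter_of_dominated_convergence _ (Eventually.of_forall hmeas)
      (Eventually.of_forall hbound) hw.2 ?_
    filter_upwards [hh] with x hx
    refine tendsto_const_nhds.congr' ?_
    filter_upwards [eventually_le_atBot ((-h x - f x) / h x)] with c hc
    rw [le_div_iff₀ hx] at hc
    rw [clip_eq_neg hx.le (by linarith)]
    ring
  rw [integral_neg] at hbot
  exact mem_range_of_exists_le_of_exists_ge hcont
    ((hbot.eventually_le_const (neg_neg_of_pos hZ)).exists)
    ((htop.eventually_const_le hZ).exists)

theorem coeFn_clip (f : X →ₘ[μ] ℝ) (c : ℝ) :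
    ∀ᵐ x ∂μ, (-(-((f + c • h) ⊓ h) ⊓ h) : X →ₘ[μ] ℝ) x = clip (f x + c * h x) (h x) := by
  filter_upwards [AEEqFun.coeFn_neg (-((f + c • h) ⊓ h) ⊓ h),
    AEEqFun.coeFn_inf (-((f + c • h) ⊓ h)) h, AEEqFun.coeFn_neg ((f + c • h) ⊓ h),
    AEEqFun.coeFn_inf (f + c • h) h, AEEqFun.coeFn_add f (c • h), AEEqFun.coeFn_smul c h]
    with x h1 h2 h3 h4 h5 h6
  rw [h1, Pi.neg_apply, h2, h3, Pi.neg_apply, h4, h5, Pi.add_apply, h6]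
  rfl

variable [SigmaFinite μ] {q : L2Form μ}

/-- Since `‖g n / h‖_∞ ≤ 1`, the right-hand side is at most `α(r) q_e(g n) + r`: fix a small `r`
first, then let `n → ∞`. -/
theorem tendsto_lintegral_sq_of_weakPoincare (hw : IsAdmissibleWeight h w)
    (hWP : q.WeakPoincare h w) (hh : StrictlyPositive h) {g : ℕ → X →ₘ[μ] ℝ}
    (hg : ∀ n, ∀ᵐ x ∂μ, |g n x| ≤ h x) (horth : ∀ n, ∫ x, g n x * h x * w x ∂μ = 0)
    (hlim : Tendsto (fun n => q.ext (g n)) atTop (𝓝 0)) :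
    Tendsto (fun n => ∫⁻ x, ENNReal.ofReal (g n x ^ 2 * w x) ∂μ) atTop (𝓝 0) := by
  obtain ⟨α, -, -, hα⟩ := hWP
  refine ENNReal.tendsto_nhds_zero.2 fun ε hε => ?_
  obtain ⟨r, hr, hrε⟩ := ENNReal.lt_iff_exists_nnreal_btwn.1 hε
  have h1 := (ENNReal.Tendsto.const_mul (a := ENNReal.ofReal (α r)) hlim
    (Or.inr ENNReal.ofReal_ne_top)).add_const (r : ℝ≥0∞)
  rw [mul_zero, zero_add] at h1
  filter_upwards [h1.eventually_le_const hrε] with n hn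
  refine (hα (g n) (integrable_sq_mul hw (hg n)) (horth n) r (by simpa using hr)).trans
    (le_trans ?_ hn)
  gcongr
  rw [ENNReal.ofReal_coe_nnreal]
  refine mul_le_of_le_one_right' (pow_le_one' ?_ 2)
  have h2 : eLpNorm (fun x => g n x / h x) ⊤ μ ≤ ENNReal.ofReal 1 := by
    rw [eLpNorm_exponent_top]
    refine eLpNormEssSup_le_of_ae_bound ?_
    filter_upwards [hg n, hh] with x h3 h4
    rw [norm_div, Real.norm_eq_abs, Real.norm_of_nonneg h4.le]
    exact (div_le_one h4).2 h3
  simpa using h2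

theorem continuous_of_weakPoincare (hBD : q.FirstBeurlingDeny) (hext : q.ext h = 0)
    (hh : StrictlyPositive h) (hw : IsAdmissibleWeight h w) (hWP : q.WeakPoincare h w)
    {ε : ℝ≥0∞} (hε : 0 < ε) : ∃ δ : ℝ, 0 < δ ∧ ∀ f : q.extDomain, q.extSeminorm f < δ →
      ∃ c : ℝ, zeroNorm μ (f + c • h) < ε := by
  by_contra! hcon
  choose f hf hfc using fun n : ℕ => hcon (1 / ((n : ℝ) + 1)) (by positivity)
  choose c hc using fun n => exists_integral_clip_eq_zero hh hw (f n : X →ₘ[μ] ℝ)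
  set F : ℕ → X →ₘ[μ] ℝ := fun n => f n + c n • h
  set g : ℕ → X →ₘ[μ] ℝ := fun n => -(-(F n ⊓ h) ⊓ h)
  have hgclip : ∀ n, ∀ᵐ x ∂μ, g n x = clip ((f n : X →ₘ[μ] ℝ) x + c n * h x) (h x) := fun n => coeFn_clip _ _
  have hext_g : Tendsto (fun n => q.ext (g n)) atTop (𝓝 0) := by
    have h1 : Tendsto (fun n : ℕ => ENNReal.ofReal ((1 / ((n : ℝ) + 1)) ^ 2)) atTop (𝓝 0) := by
      simpa using ENNReal.tendsto_ofReal
        ((tendsto_one_div_add_atTop_nhds_zero_nat (𝕜 := ℝ)).pow 2)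
    refine tendsto_of_tendsto_of_tendsto_of_le_of_le tendsto_const_nhds h1
      (fun _ => bot_le) fun n => (ext_clip_le hBD hext (F n)).trans ?_
    rw [ext_add_smul hext]
    exact ENNReal.ofReal_le_ofReal (pow_le_pow_left₀ (apply_nonneg _ _) (hf n).le 2)
  have hlim := tendsto_lintegral_sq_of_weakPoincare hw hWP hh (g := g)
    (fun n => by
      filter_upwards [hgclip n, hh] with x h1 h2
      rw [h1]
      exact abs_clip_le h2.le)
    (fun n => by
      rw [← hc n]
      refine integral_congr_ae ?_
      filter_upwards [hgclip n] with x h1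
      rw [h1]) hext_g
  obtain ⟨φ, -, hφ⟩ := exists_seq_ae_tendsto_zero_of_lintegral (fun n =>
    ((((g n).aestronglyMeasurable.pow 2).mul w.aestronglyMeasurable).aemeasurable).ennreal_ofReal)
    hlim
  have hF : ZeroTendsto μ (fun n => F (φ n)) 0 := by
    refine zeroTendsto_of_ae ?_
    filter_upwards [hφ, hh, hw.1, ae_all_iff.2 hgclip, AEEqFun.coeFn_zero (μ := μ) (β := ℝ),
      ae_all_iff.2 fun n => AEEqFun.coeFn_add (f n : X →ₘ[μ] ℝ) (c n • h),
      ae_all_iff.2 fun n => AEEqFun.coeFn_smul (c n) h] with x h1 h2 h3 h4 h5 h6 h7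
    have h8 : Tendsto (fun n => g (φ n) x) atTop (𝓝 0) := by
      have h9 := (ENNReal.tendsto_toReal ENNReal.zero_ne_top).comp h1
      have h10 := (h9.div_const (w x)).sqrt.congr (f₂ := fun n => |g (φ n) x|) fun n => by
        change √((ENNReal.ofReal (g (φ n) x ^ 2 * w x)).toReal / w x) = |g (φ n) x|
        rw [ENNReal.toReal_ofReal (by positivity), mul_div_cancel_right₀ _ h3.ne',
          Real.sqrt_sq_eq_abs]
      simp only [ENNReal.toReal_zero, zero_div, Real.sqrt_zero] at h10
      exact (tendsto_zero_iff_abs_tendsto_zero _).2 h10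
    -- Once the truncation is strictly below `h x` in absolute value it has not cut anything, so `F
    -- (φ n) x` is the same number.
    have h9 : ∀ᶠ n in atTop, |g (φ n) x| < h x := by
      have h10 := h8.abs
      rw [abs_zero] at h10
      exact h10.eventually_lt_const h2
    rw [h5]
    refine h8.congr' ?_
    filter_upwards [h9] with n hn
    rw [h4] at hn ⊢
    rw [clip_eq_left h2.le hn]
    change _ = (f (φ n) + c (φ n) • h : X →ₘ[μ] ℝ) x
    rw [h6, Pi.add_apply, h7]
    rfl
  have hF' : Tendsto (fun n => zeroNorm μ (F (φ n) - 0)) atTop (𝓝 0) := hF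
  simp only [sub_zero] at hF'
  obtain ⟨n, hn⟩ := (hF'.eventually_lt_const hε).exists
  exact absurd hn (hfc (φ n) (c (φ n))).not_gt

/-- Take `w = φ / (1 + h²)` with `φ` the fixed integrable weight, so that `w h² ≤ φ`. -/
theorem exists_isAdmissibleWeight (h : X →ₘ[μ] ℝ) : ∃ w, IsAdmissibleWeight h w := by
  have hm : AEStronglyMeasurable (fun x => (weight μ x : ℝ) / (1 + h x ^ 2)) μ :=
    ((measurable_weight μ).coe_nnreal_real.aemeasurable.div
      ((h.aestronglyMeasurable.pow 2).aemeasurable.const_add 1)).aestronglyMeasurable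
  have hint : Integrable (fun x => (weight μ x : ℝ)) μ := by
    refine ⟨(measurable_weight μ).coe_nnreal_real.aestronglyMeasurable, ?_⟩
    simpa [HasFiniteIntegral] using (lintegral_weight_lt_one μ).trans ENNReal.one_lt_top
  refine ⟨AEEqFun.mk _ hm, ?_, ?_⟩
  · filter_upwards [AEEqFun.coeFn_mk _ hm] with x hx
    rw [hx]
    have := weight_pos μ x
    positivity
  · refine hint.mono' ((AEEqFun.aestronglyMeasurable _).mul (h.aestronglyMeasurable.pow 2)) ?_
    filter_upwards [AEEqFun.coeFn_mk _ hm] with x hx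
    rw [hx, Real.norm_of_nonneg (by positivity), div_mul_eq_mul_div, div_le_iff₀ (by positivity)]
    gcongr
    linarith

end WeakPoincare

/-! ### From continuity to the weak Poincaré inequality -/

section ContinuityWeakPoincare

variable {μ : Measure X} [SigmaFinite μ] {q : L2Form μ} {h w : X →ₘ[μ] ℝ}

/-- A violation of the weak Poincaré inequality can be normalized to `|f| ≤ h`. -/
theorem exists_normalized (hh : StrictlyPositive h) (hw : IsAdmissibleWeight h w) {r C : ℝ}
    (hr : 0 < r) (hC : 0 < C) {f : X →ₘ[μ] ℝ} (horth : ∫ x, f x * h x * w x ∂μ = 0)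
    (hlt : ENNReal.ofReal C * q.ext f +
        ENNReal.ofReal r * eLpNorm (fun x => f x / h x) ⊤ μ ^ 2 <
      ∫⁻ x, ENNReal.ofReal (f x ^ 2 * w x) ∂μ) :
    ∃ g : q.extDomain, (∀ᵐ x ∂μ, |(g : X →ₘ[μ] ℝ) x| ≤ h x) ∧
      ∫ x, (g : X →ₘ[μ] ℝ) x * h x * w x ∂μ = 0 ∧
      ENNReal.ofReal r ≤ ∫⁻ x, ENNReal.ofReal ((g : X →ₘ[μ] ℝ) x ^ 2 * w x) ∂μ ∧
      C * q.extSeminorm g ^ 2 ≤ ∫ x, w x * h x ^ 2 ∂μ := by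
  set M : ℝ≥0∞ := eLpNorm (fun x => f x / h x) ⊤ μ with hM
  have hMtop : M ≠ ⊤ := by
    intro h1
    rw [h1, ENNReal.top_pow two_ne_zero, ENNReal.mul_top (by simpa using hr), add_top] at hlt
    exact not_top_lt hlt
  have hfM : ∀ᵐ x ∂μ, |f x| ≤ M.toReal * h x := by
    filter_upwards [enorm_ae_le_eLpNormEssSup (fun x => f x / h x) μ, hh] with x h1 h2
    rw [← eLpNorm_exponent_top, ← hM] at h1
    have h3 := (ENNReal.toReal_le_toReal (by simp) hMtop).2 h1
    rw [toReal_enorm, norm_div, Real.norm_eq_abs, Real.norm_of_nonneg h2.le,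
      div_le_iff₀ h2] at h3
    exact h3
  have hm : 0 < M.toReal := by
    refine lt_of_le_of_ne ENNReal.toReal_nonneg fun h1 => ?_
    have h2 : ∫⁻ x, ENNReal.ofReal (f x ^ 2 * w x) ∂μ = 0 := by
      rw [← lintegral_zero (μ := μ)]
      refine lintegral_congr_ae ?_
      filter_upwards [hfM] with x h3
      rw [← h1, zero_mul] at h3
      simp [abs_nonpos_iff.1 h3]
    rw [h2] at hlt
    exact not_lt_zero hlt
  set m := M.toReal
  have hg : ∀ᵐ x ∂μ, (m⁻¹ • f : X →ₘ[μ] ℝ) x = m⁻¹ * f x := by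
    filter_upwards [AEEqFun.coeFn_smul m⁻¹ f] with x hx
    rw [hx]
    rfl
  have hgh : ∀ᵐ x ∂μ, |(m⁻¹ • f : X →ₘ[μ] ℝ) x| ≤ h x := by
    filter_upwards [hg, hfM] with x h1 h2
    rw [h1, abs_mul, abs_of_pos (inv_pos.2 hm), inv_mul_le_iff₀ hm]
    exact h2
  have hL : ∫⁻ x, ENNReal.ofReal (f x ^ 2 * w x) ∂μ =
      ENNReal.ofReal (m ^ 2) *
        ∫⁻ x, ENNReal.ofReal ((m⁻¹ • f : X →ₘ[μ] ℝ) x ^ 2 * w x) ∂μ := by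
    rw [← lintegral_const_mul' _ _ ENNReal.ofReal_ne_top]
    refine lintegral_congr_ae ?_
    filter_upwards [hg] with x h1
    rw [← ENNReal.ofReal_mul (by positivity), h1]
    congr 1
    field_simp
  have hZ : ∫⁻ x, ENNReal.ofReal ((m⁻¹ • f : X →ₘ[μ] ℝ) x ^ 2 * w x) ∂μ ≤
      ENNReal.ofReal (∫ x, w x * h x ^ 2 ∂μ) := by
    rw [ofReal_integral_eq_lintegral_ofReal hw.2 (by
      filter_upwards [hw.1] with x h1
      positivity)]
    refine lintegral_mono_ae ?_
    filter_upwards [hgh, hw.1] with x h1 h2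
    exact ENNReal.ofReal_le_ofReal (sq_mul_le h2 h1)
  have hMm : M ^ 2 = ENNReal.ofReal (m ^ 2) := by
    rw [ENNReal.ofReal_pow hm.le, ENNReal.ofReal_toReal hMtop]
  have hm2 : ENNReal.ofReal (m ^ 2) ≠ 0 := by
    rw [ne_eq, ENNReal.ofReal_eq_zero, not_le]
    positivity
  have hfdom : f ∈ q.extDomain := by
    change q.ext f < ⊤
    by_contra h1
    rw [not_lt_top_iff.1 h1, ENNReal.mul_top (by simpa using hC), top_add] at hlt
    exact not_top_lt hlt
  -- The normalization divides by `m = ‖f / h‖_∞`, which the strict inequality forces to be finite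
  -- and nonzero.
  refine ⟨m⁻¹ • ⟨f, hfdom⟩, hgh, ?_, ?_, ?_⟩
  · have h1 : ∫ x, (m⁻¹ • f : X →ₘ[μ] ℝ) x * h x * w x ∂μ =
        ∫ x, m⁻¹ * (f x * h x * w x) ∂μ := by
      refine integral_congr_ae ?_
      filter_upwards [hg] with x h2
      rw [h2]
      ring
    rw [integral_const_mul, horth, mul_zero] at h1
    exact h1
  · have h1 := le_add_self.trans hlt.le
    rw [hL, hMm, mul_comm] at h1
    exact (ENNReal.mul_le_mul_iff_right hm2 ENNReal.ofReal_ne_top).1 h1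
  · have h1 := (le_self_add.trans hlt.le).trans (hL.le.trans (mul_le_mul_right hZ _))
    rw [ext_eq_ofReal ⟨f, hfdom⟩, ← ENNReal.ofReal_mul hC.le, ← ENNReal.ofReal_mul (by positivity),
      ENNReal.ofReal_le_ofReal_iff (mul_nonneg (by positivity) (integral_nonneg_of_ae (by
        filter_upwards [hw.1] with x h2
        positivity)))] at h1
    rw [map_smul_eq_mul, Real.norm_of_nonneg (by positivity), mul_pow, inv_pow,
      mul_left_comm, inv_mul_le_iff₀ (by positivity)]
    exact h1

theorem exists_smul_zeroTendsto
    (H : ∀ ε : ℝ≥0∞, 0 < ε → ∃ δ : ℝ, 0 < δ ∧ ∀ f : q.extDomain, q.extSeminorm f < δ →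
      ∃ c : ℝ, zeroNorm μ (f + c • h) < ε)
    {g : ℕ → q.extDomain} (hg : Tendsto (fun n => q.extSeminorm (g n)) atTop (𝓝 0)) :
    ∃ c : ℕ → ℝ, ZeroTendsto μ (fun n => (g n : X →ₘ[μ] ℝ) + c n • h) 0 := by
  have h1 : Tendsto (fun n => quotientZeroNorm h (g n : X →ₘ[μ] ℝ)) atTop (𝓝 0) := by
    refine ENNReal.tendsto_nhds_zero.2 fun ε hε => ?_
    obtain ⟨δ, hδ, hδ'⟩ := H ε hε
    filter_upwards [hg.eventually_lt_const hδ] with n hn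
    exact (quotientZeroNorm_lt_iff.2 (hδ' _ hn)).le
  -- The infimum over shifts need not be attained, hence the slack `n⁻¹`; it is `∞` for `n = 0`,
  -- which is harmless.
  have h2 : ∀ n : ℕ, ∃ c : ℝ, zeroNorm μ ((g n : X →ₘ[μ] ℝ) + c • h) ≤
      quotientZeroNorm h (g n : X →ₘ[μ] ℝ) + (n : ℝ≥0∞)⁻¹ := by
    intro n
    rcases eq_or_ne (quotientZeroNorm h (g n : X →ₘ[μ] ℝ)) ⊤ with h3 | h3
    · exact ⟨0, by simp [h3]⟩
    · obtain ⟨c, hc⟩ := quotientZeroNorm_lt_iff.1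
        (ENNReal.lt_add_right h3 (ENNReal.inv_ne_zero.2 (ENNReal.natCast_ne_top n)))
      exact ⟨c, hc.le⟩
  choose c hc using h2
  refine ⟨c, ?_⟩
  have h3 := h1.add ENNReal.tendsto_inv_nat_nhds_zero
  rw [add_zero] at h3
  refine tendsto_of_tendsto_of_tendsto_of_le_of_le tendsto_const_nhds h3
    (fun _ => bot_le) fun n => ?_
  simpa using hc n

/-- The shifts are bounded by looking at a single point and tend to `0` by orthogonality, along an
a.e. convergent subsequence. Hence `g` itself tends to `0` a.e. there, dominated by `h`. -/
theorem not_forall_le_lintegral (hh : StrictlyPositive h) (hw : IsAdmissibleWeight h w)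
    {g : ℕ → X →ₘ[μ] ℝ} {c : ℕ → ℝ} (hgh : ∀ n, ∀ᵐ x ∂μ, |g n x| ≤ h x)
    (horth : ∀ n, ∫ x, g n x * h x * w x ∂μ = 0)
    (hlim : ZeroTendsto μ (fun n => g n + c n • h) 0) {r : ℝ} (hr : 0 < r) :
    ¬ ∀ n, ENNReal.ofReal r ≤ ∫⁻ x, ENNReal.ofReal (g n x ^ 2 * w x) ∂μ := by
  intro hge
  obtain ⟨φ, -, hφ⟩ := hlim.exists_seq_ae
  have hsum : ∀ᵐ x ∂μ, Tendsto (fun n => g (φ n) x + c (φ n) * h x) atTop (𝓝 0) := by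
    filter_upwards [hφ, AEEqFun.coeFn_zero (μ := μ) (β := ℝ),
      ae_all_iff.2 fun n => AEEqFun.coeFn_add (g n) (c n • h),
      ae_all_iff.2 fun n => AEEqFun.coeFn_smul (c n) h] with x h1 h2 h3 h4
    rw [h2] at h1
    refine h1.congr fun n => ?_
    rw [h3, Pi.add_apply, h4]
    rfl
  -- Needed to pick a point from a set of full measure.
  have hμ : NeZero μ := ⟨by
    rintro rfl
    have h1 := hge 0
    simp only [lintegral_zero_measure, nonpos_iff_eq_zero, ENNReal.ofReal_eq_zero] at h1
    exact h1.not_gt hr⟩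
  -- At one good point, eventually `|c| h ≤ |g + c h| + |g| ≤ 2 h`.
  have hbdd : ∀ᶠ n in atTop, |c (φ n)| ≤ 2 := by
    obtain ⟨x, h1, h2, h3⟩ := (hsum.and (hh.and (ae_all_iff.2 hgh))).exists
    have h4 := h1.abs
    rw [abs_zero] at h4
    filter_upwards [h4.eventually_le_const h2] with n hn
    have h5 := abs_sub (g (φ n) x + c (φ n) * h x) (g (φ n) x)
    rw [add_sub_cancel_left, abs_mul, abs_of_pos h2] at h5
    have h6 := h3 (φ n)
    exact le_of_mul_le_mul_right (by linarith) h2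
  have hint : ∀ n, Integrable (fun x => g n x * h x * w x) μ := fun n =>
    hw.2.mono' (aestronglyMeasurable_mul_mul (g n).aestronglyMeasurable) (by
      filter_upwards [hgh n, hh, hw.1] with x h1 h2 h3
      exact abs_mul_mul_le h2 h3 h1)
  have hZ : 0 < ∫ x, w x * h x ^ 2 ∂μ := by
    rw [integral_pos_iff_support_of_nonneg_ae _ hw.2]
    · refine pos_iff_ne_zero.2 fun h1 => ?_
      have h2 : ∀ᵐ x ∂μ, x ∉ Function.support fun x => w x * h x ^ 2 := measure_eq_zero_iff_ae_notMem.1 h1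
      obtain ⟨x, h3, h4, h5⟩ := (h2.and (hh.and hw.1)).exists
      exact h3 (by rw [Function.mem_support]; positivity)
    · filter_upwards [hw.1] with x h1
      positivity
  have hc : Tendsto (fun n => c (φ n)) atTop (𝓝 0) := by
    have h1 : Tendsto (fun n => ∫ x, (g (φ n) x + c (φ n) * h x) * h x * w x ∂μ) atTop
        (𝓝 (∫ _, 0 ∂μ)) := by
      refine tendsto_integral_filter_of_dominated_convergence
        (fun x => 3 * (w x * h x ^ 2)) (Eventually.of_forall fun n =>
          aestronglyMeasurable_mul_mul ((g (φ n)).aestronglyMeasurable.add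
            (h.aestronglyMeasurable.const_mul _))) ?_ (hw.2.const_mul 3) ?_
      · filter_upwards [hbdd] with n hn
        filter_upwards [hgh (φ n), hh, hw.1] with x h2 h3 h4
        have h5 : |g (φ n) x + c (φ n) * h x| ≤ 3 * h x := by
          refine (abs_add_le _ _).trans ?_
          rw [abs_mul, abs_of_pos h3]
          nlinarith
        rw [Real.norm_eq_abs, abs_mul, abs_mul, abs_of_pos h3, abs_of_pos h4]
        calc _ ≤ 3 * h x * h x * w x := by gcongr
          _ = _ := by ring
      · filter_upwards [hsum] with x h2
        simpa using (h2.mul_const (h x)).mul_const (w x)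
    rw [integral_zero] at h1
    -- Orthogonality removes `g` from the integral and leaves a positive multiple of `c (φ n)`.
    have h2 : ∀ n, ∫ x, (g (φ n) x + c (φ n) * h x) * h x * w x ∂μ =
        c (φ n) * ∫ x, w x * h x ^ 2 ∂μ := by
      intro n
      rw [← integral_const_mul, ← zero_add (∫ x, c (φ n) * (w x * h x ^ 2) ∂μ),
        ← horth (φ n), ← integral_add (hint _) (hw.2.const_mul _)]
      congr 1
      ext x
      ring
    simp only [h2] at h1
    have h3 := h1.div_const (∫ x, w x * h x ^ 2 ∂μ)
    simpa [mul_div_cancel_right₀ _ hZ.ne'] using h3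
  have hg0 : Tendsto (fun n => ∫⁻ x, ENNReal.ofReal (g (φ n) x ^ 2 * w x) ∂μ) atTop
      (𝓝 (∫⁻ _, 0 ∂μ)) := by
    refine tendsto_lintegral_of_dominated_convergence'
      (fun x => ENNReal.ofReal (w x * h x ^ 2)) (fun n => ?_) (fun n => ?_)
      hw.2.lintegral_lt_top.ne ?_
    · exact (((g (φ n)).aestronglyMeasurable.pow 2).mul
        w.aestronglyMeasurable).aemeasurable.ennreal_ofReal
    · filter_upwards [hgh (φ n), hw.1] with x h1 h2
      exact ENNReal.ofReal_le_ofReal (sq_mul_le h2 h1)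
    · filter_upwards [hsum] with x h1
      have h2 := h1.sub (hc.mul_const (h x))
      simp only [add_sub_cancel_right, zero_mul, sub_zero] at h2
      simpa using ENNReal.tendsto_ofReal ((h2.pow 2).mul_const (w x))
  rw [lintegral_zero] at hg0
  have h1 := ge_of_tendsto' hg0 fun n => hge (φ n)
  rw [nonpos_iff_eq_zero, ENNReal.ofReal_eq_zero] at h1
  exact h1.not_gt hr

theorem exists_weakPoincare_const (hh : StrictlyPositive h) (hw : IsAdmissibleWeight h w)
    (H : ∀ ε : ℝ≥0∞, 0 < ε → ∃ δ : ℝ, 0 < δ ∧ ∀ f : q.extDomain, q.extSeminorm f < δ →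
      ∃ c : ℝ, zeroNorm μ (f + c • h) < ε) {r : ℝ} (hr : 0 < r) :
    ∃ C : ℝ, 0 ≤ C ∧ ∀ f : X →ₘ[μ] ℝ, ∫ x, f x * h x * w x ∂μ = 0 →
      ∫⁻ x, ENNReal.ofReal (f x ^ 2 * w x) ∂μ ≤ ENNReal.ofReal C * q.ext f +
        ENNReal.ofReal r * eLpNorm (fun x => f x / h x) ⊤ μ ^ 2 := by
  by_contra! hcon
  choose f horth hf using fun n : ℕ => hcon ((n : ℝ) + 1) (by positivity)
  choose g hgh hgorth hge hgC using fun n : ℕ =>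
    exists_normalized hh hw hr (by positivity) (horth n) (hf n)
  have hlim : Tendsto (fun n => q.extSeminorm (g n)) atTop (𝓝 0) := by
    have h1 := (tendsto_one_div_add_atTop_nhds_zero_nat (𝕜 := ℝ)).mul_const
      (∫ x, w x * h x ^ 2 ∂μ)
    rw [zero_mul] at h1
    have h2 : Tendsto (fun n => q.extSeminorm (g n) ^ 2) atTop (𝓝 0) := by
      refine squeeze_zero (fun n => sq_nonneg _) (fun n => ?_) h1
      rw [one_div, le_inv_mul_iff₀ (by positivity)]
      exact hgC n
    simpa [Real.sqrt_sq (apply_nonneg q.extSeminorm _)] using h2.sqrt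
  obtain ⟨c, hc⟩ := exists_smul_zeroTendsto H hlim
  exact not_forall_le_lintegral hh hw hgh hgorth hc hr hge

/-- The infimum of the admissible constants decreases in `r`, because a larger `r` admits more of
them. Adding `1` makes it positive and admissible even if the infimum is not attained. -/
theorem weakPoincare_of_continuous (hh : StrictlyPositive h) (hw : IsAdmissibleWeight h w)
    (H : ∀ ε : ℝ≥0∞, 0 < ε → ∃ δ : ℝ, 0 < δ ∧ ∀ f : q.extDomain, q.extSeminorm f < δ →
      ∃ c : ℝ, zeroNorm μ (f + c • h) < ε) : q.WeakPoincare h w := by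
  set S : ℝ → Set ℝ := fun r => {C | 0 ≤ C ∧ ∀ f : X →ₘ[μ] ℝ, ∫ x, f x * h x * w x ∂μ = 0 →
      ∫⁻ x, ENNReal.ofReal (f x ^ 2 * w x) ∂μ ≤ ENNReal.ofReal C * q.ext f +
        ENNReal.ofReal r * eLpNorm (fun x => f x / h x) ⊤ μ ^ 2}
  have hne : ∀ r, 0 < r → (S r).Nonempty := fun r hr => exists_weakPoincare_const hh hw H hr
  have hbdd : ∀ r, BddBelow (S r) := fun r => ⟨0, fun C hC => hC.1⟩
  refine ⟨fun r => sInf (S r) + 1, fun r hr => ?_, fun r hr s hs hrs => ?_,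
    fun f _ horth r hr => ?_⟩
  · have h1 : 0 ≤ sInf (S r) := Real.sInf_nonneg fun C hC => hC.1
    positivity
  · have hsub : S r ⊆ S s := fun C hC => ⟨hC.1, fun f hf => (hC.2 f hf).trans (by gcongr)⟩
    have h1 := csInf_le_csInf (hbdd s) (hne r hr) hsub
    simpa using h1
  · obtain ⟨C, hC, hlt⟩ := exists_lt_of_csInf_lt (hne r hr) (lt_add_one (sInf (S r)))
    exact (hC.2 f horth).trans (by gcongr)

end ContinuityWeakPoincare

end L2Form

end ExtForm

end

/-! ### The equivalence of the four assertions -/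

theorem mainTheorem3 {X : Type*} [MeasurableSpace X] (μ : MeasureTheory.Measure X)
    [MeasureTheory.SigmaFinite μ] (q : ExtForm.L2Form μ)
    (hdense : q.DenselyDefined) (hclosed : q.IsClosedForm) (hBD : q.FirstBeurlingDeny)
    (hirr : q.Irreducible) (h : X →ₘ[μ] ℝ) (hcrit : q.IsAgmonGroundState h) :
    List.TFAE
      [q.IsHilbertQuotient (Submodule.span ℝ {h}),
       q.IsContinuousQuotientMap (Submodule.span ℝ {h}),
       ∀ w : X →ₘ[μ] ℝ, ExtForm.IsAdmissibleWeight h w → q.WeakPoincare h w,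
       ∃ w : X →ₘ[μ] ℝ, ExtForm.IsAdmissibleWeight h w ∧ q.WeakPoincare h w] := by
  obtain ⟨hh, hK⟩ := hcrit
  have hker : ∀ f, q.ext f = 0 → f ∈ Submodule.span ℝ {h} := fun f hf => by
    rw [← SetLike.mem_coe, ← hK]
    exact hf
  have hext : q.ext h = 0 := by
    have h1 : h ∈ (Submodule.span ℝ {h} : Set (X →ₘ[μ] ℝ)) :=
      Submodule.mem_span_singleton_self h
    rw [← hK] at h1
    exact h1
  rw [ExtForm.L2Form.isHilbertQuotient_iff hK, ExtForm.L2Form.isContinuousQuotientMap_span_iff]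
  tfae_have 1 → 2 := fun h1 ε hε =>
    ExtForm.L2Form.continuous_of_isExtComplete hker hext h1 hε
  tfae_have 2 → 1 := ExtForm.L2Form.isExtComplete_of_continuous hext
  tfae_have 2 → 3 := fun h2 w hw => ExtForm.L2Form.weakPoincare_of_continuous hh hw h2
  tfae_have 3 → 4 := fun h3 => by
    obtain ⟨w, hw⟩ := ExtForm.L2Form.exists_isAdmissibleWeight h
    exact ⟨w, hw, h3 w hw⟩
  tfae_have 4 → 2 := fun ⟨w, hw, hWP⟩ ε hε =>
    ExtForm.L2Form.continuous_of_weakPoincare hBD hext hh hw hWP hε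
  tfae_finish
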